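/- Let $F$ be a non-archimedean local field of odd residue characteristic, let $D$ be the quaternion division algebra with center $F$ (with its natural topology as a finite-dimensional $F$-vector space), let $M$ be the unramified quadratic extension of $F$, and fix an embedding of $F$-algebras $M \hookrightarrow D$, so that $M^\times$ is a subgroup of the topological group $D^\times$. A \emph{2-fold cover} of a topological group $G$ is a topological central extension $1 \to \{\pm 1\} \to \widetilde G \to G \to 1$ that splits on a neighbourhood of the identity of $G$; the $\mathbb{C}^\times$-cover obtained from it is the central extension $1 \to \mathbb{C}^\times \to (\widetilde G \times \mathbb{C}^\times)/\langle(-1,-1)\rangle \to G \to 1$. A cover is said to split over a subgroup $H \subseteq G$ if there is a continuous homomorphism from $H$ to the total group of the cover lifting the inclusion $H \hookrightarrow G$, and to be non-trivial if it does not split over $G$. Let $\widetilde{D^\times}$ be a 2-fold cover of $D^\times$ such that the $\mathbb{C}^\times$-cover obtained from it is non-trivial. Then $\widetilde{D^\times}$ does not split over $M^\times$; moreover, the $\mathbb{C}^\times$-cover obtained from $\widetilde{D^\times}$ does not split over $M^\times$ either. -/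

import Mathlib

open scoped ValuativeRel Topology

/-- A 2-fold cover `1 → {±1} → E → G → 1` of a topological group `G`: a topological central
extension of `G` by the discrete group `{±1}` (written `ℤˣ`) which splits on a
neighbourhood of the identity. -/
structure TwoFoldCover (G E : Type*) [Group G] [TopologicalSpace G]
    [Group E] [TopologicalSpace E] [IsTopologicalGroup E] where
  /-- the inclusion of the kernel -/
  incl : ℤˣ →* E
  /-- the projection to the base -/
  proj : E →ₜ* G
  isEmbedding_incl : Topology.IsEmbedding incl
  proj_surjective : Function.Surjective proj
  exact : incl.range = proj.toMonoidHom.ker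
  central : incl.range ≤ Subgroup.center E
  locally_split : ∃ U ∈ 𝓝 (1 : G), ∃ s : G → E, ContinuousOn s U ∧
    (∀ x ∈ U, proj (s x) = x) ∧
    ∀ x ∈ U, ∀ y ∈ U, x * y ∈ U → s (x * y) = s x * s y

/-- The extension with projection `p : E → G` splits: `p` has a continuous section that is a
group homomorphism. For a central extension this says that it is trivial. -/
def ExtensionSplits {G E : Type*} [Group G] [TopologicalSpace G] [Group E] [TopologicalSpace E]
    (p : E →* G) : Prop :=
  ∃ s : G →ₜ* E, ∀ g : G, p (s g) = g

/-- The extension with projection `p : E → G` splits over the subgroup `H` of `G`, where `H`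
carries the subspace topology. -/
def ExtensionSplitsOver {G E : Type*} [Group G] [TopologicalSpace G] [Group E]
    [TopologicalSpace E] (p : E →* G) (H : Subgroup G) : Prop :=
  ∃ s : H →ₜ* E, ∀ h : H, p (s h) = h

namespace TwoFoldCover

variable {G E : Type*} [Group G] [TopologicalSpace G]
  [Group E] [TopologicalSpace E] [IsTopologicalGroup E]

/-- The subgroup `⟨(-1, -1)⟩` of `E × ℂˣ`. -/
def antidiagonal (c : TwoFoldCover G E) : Subgroup (E × ℂˣ) :=
  Subgroup.zpowers (c.incl (-1), -1)

instance antidiagonal_normal (c : TwoFoldCover G E) : c.antidiagonal.Normal := by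
  have h : ∀ g : E × ℂˣ, Commute g (c.incl (-1), -1) := fun g =>
    Prod.ext (Subgroup.mem_center_iff.1 (c.central ⟨-1, rfl⟩) g.1) (mul_comm _ _)
  refine ⟨?_⟩
  rintro _ ⟨n, rfl⟩ g
  refine ⟨n, ?_⟩
  have := ((h g).zpow_right n).eq
  simp only [this, mul_inv_cancel_right]

/-- The total group `(E × ℂˣ) / ⟨(-1, -1)⟩` of the `ℂˣ`-cover obtained from a 2-fold cover,
with the quotient topology. -/
abbrev ComplexTotal (c : TwoFoldCover G E) : Type _ := (E × ℂˣ) ⧸ c.antidiagonal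

/-- The projection of the `ℂˣ`-cover obtained from a 2-fold cover, `[(x, z)] ↦ proj x`. -/
def complexProj (c : TwoFoldCover G E) : c.ComplexTotal →* G :=
  QuotientGroup.lift c.antidiagonal (c.proj.toMonoidHom.comp (MonoidHom.fst E ℂˣ)) (by
    have h : c.incl (-1) ∈ c.proj.toMonoidHom.ker := c.exact ▸ ⟨-1, rfl⟩
    rw [antidiagonal, Subgroup.zpowers_le]
    exact h)

end TwoFoldCover

/-- A finite extension `M` of a non-archimedean local field `F` is unramified: the ring of
integers of `M`, that is the integral closure of `𝒪[F]` in `M`, is unramified over `𝒪[F]`. -/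
def IsUnramifiedExtension (F M : Type*) [Field F] [ValuativeRel F] [Field M] [Algebra F M] :
    Prop :=
  Algebra.FormallyUnramified 𝒪[F] (integralClosure 𝒪[F] M)

/-! The contrapositive is proved: if the `ℂˣ`-cover splits over `Mˣ`, it splits over `Dˣ`. Let q be
the cardinality of the residue field of F and U the group of principal units of D. Since q is odd, U
is pro-odd, so a cover by signs lifts U to a subgroup S that is normal in the whole cover
(`TwoFoldCover.exists_normal_lift`). Dividing by the image of S leaves a central extension of Dˣ/U
by ℂˣ, and Dˣ/U is generated by z, of order q² - 1, coming from the residue field of M, and a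
uniformizer w with w z w⁻¹ = z^q and w² in Fˣ.

As z and w² lie in Mˣ and commute, a splitting over Mˣ gives commuting lifts of them. Let a lift z
with a^(q² - 1) = 1 and let b lift w. Then b a b⁻¹ = t a^q for a scalar t, and commutation of a with
b² forces t^(q + 1) = 1. Scaling a by d with d^(q - 1) = t removes t and preserves a^(q² - 1) = 1,
so a and b generate a complement to ℂˣ (`exists_complement_of_commute`). Its preimage is a section
over Dˣ, continuous because near 1 it is the local splitting
(`TwoFoldCover.extensionSplits_complexProj`).

The arithmetic input is that M = F(√ε) for a unit ε with nonsquare residue, and D = M + Mj with j² a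
uniformizer of F and j anticommuting with √ε. The valuation of the reduced norm is then explicit in
coordinates and yields both the topology of D and the structure of Dˣ/U. -/

/-! ### Central extensions of abstract groups -/

section CentralExtensions

variable {X Y : Type*} [Group X] [Group Y]

/-- A central extension by `{±1}` which splits over a subgroup of odd index, with normal image,
splits: transfer provides a retraction onto the kernel. -/
theorem exists_retraction_of_odd_index (p : X →* Y) (hp : Function.Surjective p)
    (ι : ℤˣ →* X) (hι : Function.Injective ι) (hex : ι.range = p.ker)
    (hcent : ι.range ≤ Subgroup.center X) (V : Subgroup Y) (hV : Odd V.index)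
    (s : V →* X) (hs : ∀ v, p (s v) = v) (hn : s.range.Normal) :
    ∃ τ : X →* ℤˣ, (∀ e, τ (ι e) = e) ∧ ∀ v, τ (s v) = 1 := by
  classical
  have hpι : ∀ e, p (ι e) = 1 := fun e => by
    have : ι e ∈ p.ker := hex ▸ ⟨e, rfl⟩
    exact this
  have hc : ∀ e x, x * ι e = ι e * x := fun e x =>
    Subgroup.mem_center_iff.1 (hcent ⟨e, rfl⟩) x
  -- The preimage of V is the product of `ι.range` and `s.range`; f is the projection to the sign.
  have hex' : ∀ h : V.comap p, ∃ e, ι e = h * (s ⟨p h, h.2⟩)⁻¹ := fun h => by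
    have : (h : X) * (s ⟨p h, h.2⟩)⁻¹ ∈ p.ker := by
      rw [MonoidHom.mem_ker, map_mul, map_inv, hs, mul_inv_cancel]
    rw [← hex] at this
    exact this
  choose f hf using hex'
  have hmul : ∀ a b, f (a * b) = f a * f b := fun a b => by
    apply hι
    have e : (⟨p ((a * b : V.comap p) : X), (a * b).2⟩ : V) = ⟨p a, a.2⟩ * ⟨p b, b.2⟩ :=
      Subtype.ext (by simp)
    rw [map_mul, hf (a * b), e, map_mul, mul_inv_rev, hf a, mul_assoc (a : X), hc, hf b]
    simp only [Subgroup.coe_mul, mul_assoc]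
  let φ : V.comap p →* ℤˣ := MonoidHom.mk' f hmul
  have hidx : (V.comap p).index = V.index := Subgroup.index_comap_of_surjective _ hp
  have : (V.comap p).FiniteIndex := ⟨by rw [hidx]; exact hV.pos.ne'⟩
  have hφι : ∀ x (hx : x ∈ V.comap p) e, x = ι e → φ ⟨x, hx⟩ = e := by
    rintro _ hx e rfl
    apply hι
    have h1 : (⟨p (ι e), hx⟩ : V) = 1 := Subtype.ext (hpι e)
    exact (hf ⟨ι e, hx⟩).trans (by rw [h1, map_one, inv_one, mul_one])
  have hφs : ∀ x (hx : x ∈ V.comap p), x ∈ s.range → φ ⟨x, hx⟩ = 1 := by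
    rintro _ hx ⟨v, rfl⟩
    apply hι
    change ι (f _) = _
    rw [hf, map_one]
    simp [hs]
  -- On central signs transfer is the power by the index, hence the identity. On s v it is a product
  -- of φ at conjugates of powers of s v, which stay in `s.range` by normality.
  refine ⟨φ.transfer, fun e => ?_, fun v => ?_⟩
  · rw [MonoidHom.transfer_eq_pow]
    · refine hφι _ _ _ ?_
      rw [← map_pow, hidx, Int.units_pow_eq_pow_mod_two, Nat.odd_iff.1 hV, pow_one]
    · intro k g _
      rw [← map_pow, mul_assoc, ← hc, inv_mul_cancel_left]
  · have := Fintype.ofFinite (Quotient (MulAction.orbitRel (Subgroup.zpowers (s v)) (X ⧸ V.comap p)))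
    rw [MonoidHom.transfer_eq_prod_quotient_orbitRel_zpowers_quot]
    refine Finset.prod_eq_one fun q _ => hφs _ _ ?_
    have := hn.conj_mem _ (pow_mem (⟨v, rfl⟩ : s v ∈ s.range)
      (Function.minimalPeriod (fun x => s v • x) q.out)) (Quotient.out q.out)⁻¹
    simpa using this

/-- Conjugates of an element of a partial section of an extension by `{±1}` lie in the section
as soon as conjugates of an odd power of it do. -/
theorem conj_mem_of_conj_odd_pow_mem (p : X →* Y) (ι : ℤˣ →* X) (hex : ι.range = p.ker)
    (hcent : ι.range ≤ Subgroup.center X) (S : Subgroup X) (hS : ∀ x ∈ S, p x = 1 → x = 1)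
    (hn : (S.map p).Normal) {x g : X} (hx : x ∈ S) {m : ℕ} (hm : Odd m)
    (h : g * x ^ m * g⁻¹ ∈ S) : g * x * g⁻¹ ∈ S := by
  obtain ⟨y, hy, hyx⟩ := hn.conj_mem _ (Subgroup.mem_map_of_mem p hx) (p g)
  have hk : g * x * g⁻¹ * y⁻¹ ∈ p.ker := by
    rw [MonoidHom.mem_ker, map_mul, map_inv, hyx]; simp
  rw [← hex] at hk
  obtain ⟨e, he⟩ := hk
  have hgx : g * x * g⁻¹ = ι e * y := by rw [he]; simp
  have hc : Commute (ι e) y := (Subgroup.mem_center_iff.1 (hcent ⟨e, rfl⟩) y).symm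
  -- The sign e by which the conjugate of x misses S survives an odd power, so it is detected there.
  have h2 : g * x ^ m * g⁻¹ = ι e * y ^ m := by
    rw [← conj_pow, hgx, hc.mul_pow, ← map_pow, Int.units_pow_eq_pow_mod_two, Nat.odd_iff.1 hm,
      pow_one]
  have h3 : ι e ∈ S := by
    have := mul_mem h (inv_mem (pow_mem hy m))
    rwa [h2, mul_inv_cancel_right] at this
  have h4 : ι e = 1 := hS _ h3 (by
    have : ι e ∈ p.ker := hex ▸ ⟨e, rfl⟩
    exact this)
  rw [hgx, h4, one_mul]; exact hy

/-- A subgroup mapped isomorphically onto the base of an extension gives a section. -/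
theorem exists_section_of_complement (p : X →* Y) (H : Subgroup X)
    (hinj : ∀ x ∈ H, p x = 1 → x = 1) (hsurj : ∀ y, ∃ x ∈ H, p x = y) :
    ∃ σ : Y →* X, (∀ y, p (σ y) = y) ∧ ∀ x ∈ H, σ (p x) = x := by
  choose f hf hpf using hsurj
  have huniq : ∀ x ∈ H, ∀ y ∈ H, p x = p y → x = y := fun x hx y hy h => by
    have := hinj (x * y⁻¹) (mul_mem hx (inv_mem hy)) (by simp [h])
    exact mul_inv_eq_one.1 this
  refine ⟨MonoidHom.mk' f fun a b => huniq _ (hf _) _ (mul_mem (hf _) (hf _)) (by simp [hpf]),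
    hpf, fun x hx => huniq _ (hf _) _ hx (hpf _)⟩

/-- Let `Y` be generated by `z` and `w` with `w z w⁻¹ = z ^ q`, where `z` has order `q² - 1` and
`⟨z⟩ ∩ ⟨w⟩ = 1` with `w` of infinite order. A central extension of `Y` by `ℂˣ` in which lifts of
`z` and `w²` commute has a complement to its kernel. -/
theorem exists_complement_of_commute (p : X →* Y) (hp : Function.Surjective p)
    (κ : ℂˣ →* X) (hκ : Function.Injective κ) (hex : κ.range = p.ker)
    (hcent : κ.range ≤ Subgroup.center X) {z w : Y} {q : ℕ} (hq : 1 < q)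
    (hgen : ∀ y, ∃ i k : ℤ, y = z ^ i * w ^ k)
    (hord : ∀ i k : ℤ, z ^ i * w ^ k = 1 → k = 0 ∧ (((q - 1) * (q + 1) : ℕ) : ℤ) ∣ i)
    (hz : z ^ ((q - 1) * (q + 1)) = 1) (hw : w * z * w⁻¹ = z ^ q)
    {a₀ b₀ : X} (ha₀ : p a₀ = z) (hb₀ : p b₀ = w ^ 2) (hab : Commute a₀ b₀) :
    ∃ H : Subgroup X, (∀ x ∈ H, p x = 1 → x = 1) ∧ ∀ y, ∃ x ∈ H, p x = y := by
  have hker : ∀ x, p x = 1 → ∃ e, κ e = x := fun x hx => by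
    have : x ∈ p.ker := hx
    rw [← hex] at this
    exact this
  have hpκ : ∀ e, p (κ e) = 1 := fun e => by
    have : κ e ∈ p.ker := hex ▸ ⟨e, rfl⟩
    exact this
  have hc : ∀ e x, Commute (κ e) x := fun e x =>
    (Subgroup.mem_center_iff.1 (hcent ⟨e, rfl⟩) x).symm
  -- Divisibility of the kernel is what makes both corrections below possible; it fails for {±1}.
  have hroot : ∀ (e : ℂˣ) {n : ℕ}, 0 < n → ∃ d : ℂˣ, d ^ n = e := fun e n hn => by
    obtain ⟨d, hd⟩ := IsAlgClosed.exists_pow_nat_eq (e : ℂ) hn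
    have hd0 : d ≠ 0 := by rintro rfl; rw [zero_pow hn.ne'] at hd; exact e.ne_zero hd.symm
    exact ⟨Units.mk0 d hd0, Units.ext (by simpa using hd)⟩
  obtain ⟨b, hb⟩ := hp w
  set n := (q - 1) * (q + 1) with hn
  have hq1 : 0 < q - 1 := by omega
  have hn0 : 0 < n := Nat.mul_pos hq1 (by omega)
  have hqq : q * q = n + 1 := by
    obtain ⟨r, rfl⟩ : ∃ r, q = r + 1 := ⟨q - 1, by omega⟩
    rw [hn]; simp; ring
  -- a lift of `z` of order dividing `n`
  obtain ⟨a₁, ha₁, ha₁n⟩ : ∃ a₁, p a₁ = z ∧ a₁ ^ n = 1 := by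
    obtain ⟨e, he⟩ := hker (a₀ ^ n) (by rw [map_pow, ha₀, hz])
    obtain ⟨d, hd⟩ := hroot e⁻¹ hn0
    refine ⟨κ d * a₀, by rw [map_mul, hpκ, ha₀, one_mul], ?_⟩
    rw [(hc d a₀).mul_pow, ← map_pow, hd, ← he, ← map_mul, inv_mul_cancel, map_one]
  -- Commutators do not change when elements are multiplied by central ones, so any lifts of z and
  -- w² commute.
  have hcomm : ∀ a, p a = z → Commute a (b ^ 2) := fun a ha => by
    obtain ⟨e, he⟩ := hker (a * a₀⁻¹) (by rw [map_mul, map_inv, ha, ha₀, mul_inv_cancel])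
    obtain ⟨e', he'⟩ := hker (b ^ 2 * b₀⁻¹) (by rw [map_mul, map_inv, map_pow, hb, hb₀, mul_inv_cancel])
    rw [← inv_mul_cancel_right a a₀, ← he, ← inv_mul_cancel_right (b ^ 2) b₀, ← he']
    exact ((hc _ _).mul_left ((hc _ _).symm.mul_right hab))
  obtain ⟨t, ht⟩ := hker (b * a₁ * b⁻¹ * (a₁ ^ q)⁻¹) (by simp [hb, ha₁, hw])
  have hbt : b * a₁ * b⁻¹ = κ t * a₁ ^ q := by rw [ht]; simp
  -- Conjugating a₁ twice by b gives t^(q + 1) a₁^(q²), and a₁^(q²) = a₁.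
  have htq : t ^ (q + 1) = 1 := by
    apply hκ
    have h1 : b ^ 2 * a₁ * (b ^ 2)⁻¹ = a₁ := by
      rw [← (hcomm a₁ ha₁).eq, mul_inv_cancel_right]
    have h2 : b ^ 2 * a₁ * (b ^ 2)⁻¹ = b * (b * a₁ * b⁻¹) * b⁻¹ := by
      rw [pow_two, mul_inv_rev]; simp only [mul_assoc]
    have h3 : b * (b * a₁ * b⁻¹) * b⁻¹ = κ t * (b * a₁ * b⁻¹) ^ q := by
      rw [conj_pow, hbt, ← mul_assoc, ← (hc t b).eq]; simp only [mul_assoc]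
    rw [h2, h3, hbt, (hc _ _).mul_pow, ← mul_assoc, ← pow_mul, hqq, pow_succ, ha₁n, one_mul] at h1
    rw [pow_succ', map_mul, map_pow, map_one]
    exact mul_eq_right.1 h1
  obtain ⟨d, hd⟩ := hroot t hq1
  -- the corrected lift of `z`
  set a := κ d * a₁ with ha
  have hpa : p a = z := by rw [ha, map_mul, hpκ, ha₁, one_mul]
  have han : a ^ n = 1 := by
    rw [ha, (hc _ _).mul_pow, ha₁n, mul_one, hn, pow_mul, ← map_pow, hd, ← map_pow, htq, map_one]
  have hba : b * a * b⁻¹ = a ^ q := by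
    have : b * a * b⁻¹ = κ d * (b * a₁ * b⁻¹) := by
      rw [ha, ← mul_assoc, ← (hc d b).eq]; simp only [mul_assoc]
    rw [this, hbt, ha, (hc _ _).mul_pow, ← mul_assoc, ← map_mul, ← map_pow]
    congr 2
    rw [← hd, ← pow_succ']
    congr 1; omega
  -- Since b² centralizes a, b and b⁻¹ act on a in the same way; this gives the reverse inclusion
  -- for the normalizer.
  have hba' : b⁻¹ * a * b = a ^ q := by
    have h1 : b ^ 2 * (b⁻¹ * a * b) * (b ^ 2)⁻¹ = b ^ 2 * a ^ q * (b ^ 2)⁻¹ := by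
      rw [← ((hcomm a hpa).pow_left q).eq, mul_inv_cancel_right, ← hba, pow_two, mul_inv_rev]
      simp [mul_assoc]
    exact mul_left_cancel (mul_right_cancel h1)
  have hnorm : Subgroup.zpowers b ≤ Subgroup.normalizer (Subgroup.zpowers a : Set X) := by
    rw [Subgroup.zpowers_le, Subgroup.mem_normalizer_iff]
    intro h
    constructor
    · rintro ⟨i, rfl⟩
      refine ⟨q * i, ?_⟩
      simp only
      rw [← conj_zpow, hba, zpow_mul, zpow_natCast]
    · rintro ⟨i, hi⟩
      refine ⟨q * i, ?_⟩
      simp only at hi ⊢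
      rw [zpow_mul, zpow_natCast, ← hba']
      have := conj_zpow (i := i) (a := b⁻¹) (b := a)
      rw [inv_inv] at this
      rw [this, hi]; simp [mul_assoc]
  have hmem : ∀ x ∈ Subgroup.zpowers b ⊔ Subgroup.zpowers a, ∃ i k : ℤ, x = a ^ i * b ^ k := by
    intro x hx
    -- The product set has the powers of b on the left; passing to the inverse puts those of a
    -- first.
    rw [← inv_mem_iff] at hx
    have hx' : x⁻¹ ∈ ((Subgroup.zpowers b ⊔ Subgroup.zpowers a : Subgroup X) : Set X) := hx
    rw [Subgroup.coe_mul_of_left_le_normalizer_right _ _ hnorm] at hx'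
    obtain ⟨_, ⟨k, rfl⟩, _, ⟨i, rfl⟩, h⟩ := hx'
    refine ⟨-i, -k, ?_⟩
    rw [← inv_inv x, ← h]
    simp
  refine ⟨Subgroup.zpowers b ⊔ Subgroup.zpowers a, fun x hx hpx => ?_, fun y => ?_⟩
  · obtain ⟨i, k, rfl⟩ := hmem x hx
    rw [map_mul, map_zpow, map_zpow, hpa, hb] at hpx
    obtain ⟨rfl, r, rfl⟩ := hord i k hpx
    rw [zpow_mul, zpow_natCast, han]; simp
  · obtain ⟨i, k, rfl⟩ := hgen y
    refine ⟨a ^ i * b ^ k, mul_mem ?_ ?_, by rw [map_mul, map_zpow, map_zpow, hpa, hb]⟩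
    · exact Subgroup.mem_sup_right ⟨i, rfl⟩
    · exact Subgroup.mem_sup_left ⟨k, rfl⟩

end CentralExtensions

/-! ### Lifting pro-odd subgroups, and the `ℂˣ`-cover -/

section Covers

variable {G E : Type*} [Group G] [TopologicalSpace G]
  [Group E] [TopologicalSpace E] [IsTopologicalGroup E]

namespace TwoFoldCover

theorem proj_incl (c : TwoFoldCover G E) (e : ℤˣ) : c.proj (c.incl e) = 1 := by
  have : c.incl e ∈ c.proj.toMonoidHom.ker := c.exact ▸ ⟨e, rfl⟩
  exact this

theorem exists_incl_of_proj_eq_one (c : TwoFoldCover G E) {x : E} (hx : c.proj x = 1) :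
    ∃ e, c.incl e = x := by
  have : x ∈ c.proj.toMonoidHom.ker := hx
  rw [← c.exact] at this
  exact this

/-- The kernel of a 2-fold cover is discrete. -/
theorem eventually_eq_one_of_proj (c : TwoFoldCover G E) :
    ∀ᶠ x in 𝓝 (1 : E), c.proj x = 1 → x = 1 := by
  have h : {(1 : ℤˣ)} ∈ Filter.comap c.incl (𝓝 (c.incl 1)) := by
    rw [← c.isEmbedding_incl.nhds_eq_comap]; simp
  obtain ⟨O, hO, hO'⟩ := h
  rw [map_one] at hO
  filter_upwards [hO] with x hx hpx
  obtain ⟨e, rfl⟩ := c.exists_incl_of_proj_eq_one hpx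
  rw [Set.mem_singleton_iff.1 (hO' hx), map_one]

/-- A 2-fold cover splits, equivariantly for conjugation, over a normal subgroup in which the
open normal subgroups of odd index are cofinal. -/
theorem exists_normal_lift [IsTopologicalGroup G] (c : TwoFoldCover G E) (U : Subgroup G)
    (hUn : U.Normal)
    (hU : ∀ W ∈ 𝓝 (1 : G), ∃ V : Subgroup G, V.Normal ∧ (V : Set G) ∈ 𝓝 1 ∧ V ≤ U ∧
      (V : Set G) ⊆ W ∧ Odd (V.relIndex U)) :
    ∃ S : Subgroup E, S.Normal ∧ S.map c.proj.toMonoidHom = U ∧ (∀ x ∈ S, c.proj x = 1 → x = 1) ∧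
      ∃ s : G → E, ContinuousAt s 1 ∧ s 1 = 1 ∧ ∀ᶠ x in 𝓝 1, s x ∈ S ∧ c.proj (s x) = x := by
  obtain ⟨W, hW, s, hcont, hps, hmul⟩ := c.locally_split
  obtain ⟨V, hVn, hV, hVU, hVW, hVo⟩ := hU W hW
  let sV : V →* E := MonoidHom.mk' (fun v => s v) fun a b =>
    hmul _ (hVW a.2) _ (hVW b.2) (hVW (a * b).2)
  have hsV : ∀ v : V, c.proj (sV v) = v := fun v => hps _ (hVW v.2)
  have hs1 : s 1 = 1 := map_one sV
  have hsc : ContinuousAt s 1 := hcont.continuousAt hW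
  have hsVinj : ∀ x ∈ sV.range, c.proj x = 1 → x = 1 := by
    rintro _ ⟨v, rfl⟩ h
    rw [hsV] at h
    rw [show v = 1 from Subtype.ext h, map_one]
  have hsVmap : sV.range.map c.proj.toMonoidHom = V := by
    ext x
    constructor
    · rintro ⟨_, ⟨v, rfl⟩, rfl⟩
      change c.proj (sV v) ∈ V
      rw [hsV]; exact v.2
    · exact fun hx => ⟨sV ⟨x, hx⟩, ⟨_, rfl⟩, hsV _⟩
  have hn : sV.range.Normal := by
    refine ⟨?_⟩
    rintro _ ⟨v, rfl⟩ g
    -- f measures how far s is from commuting with conjugation by g. It takes values in the discrete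
    -- kernel near 1 and is continuous at 1, so it is trivial on a smaller V'; odd powers then carry
    -- this from V' to V.
    let f : G → E := fun x => g * s x * g⁻¹ * (s (c.proj g * x * (c.proj g)⁻¹))⁻¹
    have hf1 : f 1 = 1 := by simp [f, hs1]
    have hfc : ContinuousAt f 1 := by
      have h1 : ContinuousAt (fun x => s (c.proj g * x * (c.proj g)⁻¹)) 1 := by
        refine ContinuousAt.comp (g := s) ?_ (by fun_prop)
        simpa using hsc
      exact ((continuousAt_const.mul hsc).mul continuousAt_const).mul h1.inv
    have hev : ∀ᶠ x in 𝓝 (1 : G), c.proj (f x) = 1 → f x = 1 :=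
      hfc.eventually (by rw [hf1]; exact c.eventually_eq_one_of_proj)
    obtain ⟨V', hVn', hV', hVU', hVW', hVo'⟩ := hU _ (Filter.inter_mem hV hev)
    have hV'V : V' ≤ V := fun x hx => (hVW' hx).1
    refine conj_mem_of_conj_odd_pow_mem c.proj.toMonoidHom c.incl c.exact c.central _
      hsVinj (by rwa [hsVmap]) ⟨v, rfl⟩ (m := V'.relIndex V) ?_ ?_
    · rw [← Subgroup.relIndex_mul_relIndex V' V U hV'V hVU] at hVo'
      exact (Nat.odd_mul.1 hVo').1
    · have hvm : ((v ^ V'.relIndex V : V) : G) ∈ V' := Subgroup.pow_index_mem (V'.subgroupOf V) v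
      have hvc : c.proj g * ((v ^ V'.relIndex V : V) : G) * (c.proj g)⁻¹ ∈ V :=
        hVn.conj_mem _ (v ^ V'.relIndex V).2 _
      have := (hVW' hvm).2 (by
        have h1 := hps _ (hVW (v ^ V'.relIndex V).2)
        have h2 := hps _ (hVW hvc)
        simp only [f, map_mul, map_inv, h1, h2]; simp)
      refine ⟨⟨_, hvc⟩, ?_⟩
      rw [← map_pow]
      exact (mul_inv_eq_one.1 this).symm
  have hincl : ∀ e, c.incl e ∈ U.comap c.proj.toMonoidHom := fun e => by
    change c.proj (c.incl e) ∈ U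
    rw [c.proj_incl]; exact one_mem U
  let p : U.comap c.proj.toMonoidHom →* U := c.proj.toMonoidHom.subgroupComap U
  let ι : ℤˣ →* U.comap c.proj.toMonoidHom := c.incl.codRestrict _ hincl
  let s' : V.subgroupOf U →* U.comap c.proj.toMonoidHom :=
    (sV.comp ((Subgroup.subgroupOfEquivOfLe hVU).toMonoidHom)).codRestrict _ fun v => by
      change c.proj (sV _) ∈ U
      rw [hsV]; exact v.1.2
  have hs' : ∀ v : V.subgroupOf U, ((s' v : U.comap c.proj.toMonoidHom) : E) = sV ⟨v.1.1, v.2⟩ :=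
    fun v => rfl
  have hs'n : s'.range.Normal := by
    refine ⟨?_⟩
    rintro _ ⟨v, rfl⟩ g
    obtain ⟨v', hv'⟩ := hn.conj_mem _ ⟨⟨v.1.1, v.2⟩, rfl⟩ (g : E)
    exact ⟨⟨⟨v', hVU v'.2⟩, v'.2⟩, Subtype.ext ((hs' _).trans hv')⟩
  -- The kernel of the retraction τ is the required S: it maps isomorphically onto U and contains
  -- the lift of V.
  obtain ⟨τ, hτι, hτs⟩ := exists_retraction_of_odd_index p
    (fun u => by
      obtain ⟨x, hx⟩ := c.proj_surjective u
      have hx' : c.proj.toMonoidHom x = u := hx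
      exact ⟨⟨x, by rw [Subgroup.mem_comap, hx']; exact u.2⟩, Subtype.ext hx⟩)
    ι (fun a b h => c.isEmbedding_incl.injective (congrArg Subtype.val h))
    (by
      ext x
      constructor
      · rintro ⟨e, rfl⟩
        exact Subtype.ext (c.proj_incl e)
      · intro h
        obtain ⟨e, he⟩ := c.exists_incl_of_proj_eq_one (congrArg Subtype.val h)
        exact ⟨e, Subtype.ext he⟩)
    (by
      rintro _ ⟨e, rfl⟩
      rw [Subgroup.mem_center_iff]
      exact fun g => Subtype.ext (Subgroup.mem_center_iff.1 (c.central ⟨e, rfl⟩) g))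
    (V.subgroupOf U) hVo s' (fun v => Subtype.ext (hsV _)) hs'n
  have hSinj : ∀ x ∈ τ.ker.map (Subgroup.subtype _), c.proj x = 1 → x = 1 := by
    rintro _ ⟨x, hx, rfl⟩ h
    obtain ⟨e, he⟩ := c.exists_incl_of_proj_eq_one h
    have hxe : x = ι e := Subtype.ext he.symm
    have hx' : τ x = 1 := hx
    rw [hxe, hτι] at hx'
    rw [hxe, hx', map_one, map_one]
  have hSmap : (τ.ker.map (Subgroup.subtype _)).map c.proj.toMonoidHom = U := by
    ext u
    constructor
    · rintro ⟨_, ⟨x, hx, rfl⟩, rfl⟩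
      exact x.2
    · intro hu
      obtain ⟨x, hx⟩ := c.proj_surjective u
      have hx' : c.proj.toMonoidHom x = u := hx
      let y : U.comap c.proj.toMonoidHom := ⟨x, by rw [Subgroup.mem_comap, hx']; exact hu⟩
      refine ⟨_, ⟨y * (ι (τ y))⁻¹, ?_, rfl⟩, ?_⟩
      · change τ _ = 1
        rw [map_mul, map_inv, hτι, mul_inv_cancel]
      · change c.proj (x * (c.incl (τ y))⁻¹) = u
        rw [map_mul, map_inv, c.proj_incl, inv_one, mul_one, hx]
  have hSs : ∀ v : V, sV v ∈ τ.ker.map (Subgroup.subtype _) := fun v =>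
    ⟨s' ⟨⟨v, hVU v.2⟩, v.2⟩, hτs _, rfl⟩
  refine ⟨τ.ker.map (Subgroup.subtype _), ⟨fun x hx g => ?_⟩, hSmap, hSinj, s, hsc, hs1, ?_⟩
  -- The power `V.relIndex U` of an element of S lies in the lift of V, already known to be normal.
  · refine conj_mem_of_conj_odd_pow_mem c.proj.toMonoidHom c.incl c.exact c.central _
      hSinj (by rwa [hSmap]) hx hVo ?_
    have hxU : c.proj x ∈ U := by rw [← hSmap]; exact ⟨x, hx, rfl⟩
    have hxm : c.proj (x ^ V.relIndex U) ∈ V := by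
      rw [map_pow]
      exact Subgroup.pow_index_mem (V.subgroupOf U) ⟨_, hxU⟩
    have hxs : x ^ V.relIndex U = sV ⟨_, hxm⟩ := by
      refine mul_inv_eq_one.1 (hSinj _ (mul_mem (pow_mem hx _) (inv_mem (hSs _))) ?_)
      rw [map_mul, map_inv, hsV, mul_inv_cancel]
    obtain ⟨v, hv⟩ := hn.conj_mem _ ⟨⟨_, hxm⟩, rfl⟩ g
    rw [hxs, ← hv]
    exact hSs v
  · filter_upwards [hV] with x hx
    exact ⟨hSs ⟨x, hx⟩, hsV ⟨x, hx⟩⟩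

/-- The map from a 2-fold cover to the `ℂˣ`-cover obtained from it. -/
def toComplex (c : TwoFoldCover G E) : E →* c.ComplexTotal :=
  (QuotientGroup.mk' c.antidiagonal).comp (MonoidHom.inl E ℂˣ)

/-- The inclusion of `ℂˣ` in the `ℂˣ`-cover obtained from a 2-fold cover. -/
def complexIncl (c : TwoFoldCover G E) : ℂˣ →* c.ComplexTotal :=
  (QuotientGroup.mk' c.antidiagonal).comp (MonoidHom.inr E ℂˣ)

theorem continuous_toComplex (c : TwoFoldCover G E) : Continuous c.toComplex :=
  continuous_quot_mk.comp (Continuous.prodMk_left 1)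

theorem complexProj_toComplex (c : TwoFoldCover G E) (x : E) :
    c.complexProj (c.toComplex x) = c.proj x := rfl

theorem complexProj_complexIncl (c : TwoFoldCover G E) (z : ℂˣ) :
    c.complexProj (c.complexIncl z) = 1 := map_one c.proj

theorem mk_eq_mul (c : TwoFoldCover G E) (x : E) (z : ℂˣ) :
    (QuotientGroup.mk (x, z) : c.ComplexTotal) = c.toComplex x * c.complexIncl z := by
  change _ = QuotientGroup.mk ((x, 1) * (1, z))
  simp

theorem toComplex_incl_neg_one (c : TwoFoldCover G E) :
    c.toComplex (c.incl (-1)) = c.complexIncl (-1) := by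
  refine QuotientGroup.eq.2 ⟨-1, ?_⟩
  simp [MonoidHom.inl, MonoidHom.inr]

theorem commute_complexIncl (c : TwoFoldCover G E) (z : ℂˣ) (t : c.ComplexTotal) :
    Commute (c.complexIncl z) t := by
  obtain ⟨⟨x, y⟩, rfl⟩ := QuotientGroup.mk_surjective t
  refine congrArg QuotientGroup.mk (Prod.ext ?_ (mul_comm z y))
  exact (one_mul x).trans (mul_one x).symm

theorem complexIncl_range (c : TwoFoldCover G E) : c.complexIncl.range = c.complexProj.ker := by
  ext t
  constructor
  · rintro ⟨z, rfl⟩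
    exact c.complexProj_complexIncl z
  · obtain ⟨⟨x, z⟩, rfl⟩ := QuotientGroup.mk_surjective t
    intro h
    obtain ⟨e, rfl⟩ := c.exists_incl_of_proj_eq_one (show c.proj x = 1 from h)
    rw [c.mk_eq_mul]
    rcases Int.units_eq_one_or e with rfl | rfl
    · exact ⟨z, by simp⟩
    · exact ⟨-1 * z, by rw [map_mul, c.toComplex_incl_neg_one]⟩

theorem complexProj_surjective (c : TwoFoldCover G E) : Function.Surjective c.complexProj :=
  fun g => by
    obtain ⟨x, hx⟩ := c.proj_surjective g
    exact ⟨c.toComplex x, hx⟩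

/-- The subgroup divided out is {1, (-1, -1)}. In the second case the first coordinate alone
suffices for injectivity of `complexIncl`. -/
theorem toComplex_mul_complexIncl_eq_one (c : TwoFoldCover G E) {x : E} {z : ℂˣ}
    (h : c.toComplex x * c.complexIncl z = 1) : (x = 1 ∧ z = 1) ∨ x = c.incl (-1) := by
  rw [← c.mk_eq_mul] at h
  obtain ⟨n, hn⟩ := (QuotientGroup.eq_one_iff _).1 h
  rcases Int.even_or_odd n with ⟨k, rfl⟩ | ⟨k, rfl⟩
  · left
    simp only [← two_mul, zpow_mul] at hn
    have h1 : ((c.incl (-1), -1) : E × ℂˣ) ^ (2 : ℤ) = 1 :=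
      Prod.ext (by change c.incl (-1) ^ (2 : ℤ) = 1; rw [← map_zpow]; simp) (by simp)
    rw [h1, one_zpow] at hn
    exact ⟨(congrArg Prod.fst hn).symm, (congrArg Prod.snd hn).symm⟩
  · right
    simp only [zpow_add, zpow_mul, zpow_one] at hn
    have h1 : ((c.incl (-1), -1) : E × ℂˣ) ^ (2 : ℤ) = 1 :=
      Prod.ext (by change c.incl (-1) ^ (2 : ℤ) = 1; rw [← map_zpow]; simp) (by simp)
    rw [h1, one_zpow, one_mul] at hn
    exact (congrArg Prod.fst hn).symm

theorem complexIncl_injective (c : TwoFoldCover G E) : Function.Injective c.complexIncl := by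
  rw [injective_iff_map_eq_one]
  intro z hz
  rcases c.toComplex_mul_complexIncl_eq_one (x := 1) (z := z) (by rw [hz, map_one, one_mul]) with
    h | h
  · exact h.2
  · rw [← map_one c.incl] at h
    exact absurd (c.isEmbedding_incl.injective h) (by decide)

end TwoFoldCover

/-- A 2-fold cover of a group `G` with an open normal subgroup `U` which is pro-odd, such that
`G ⧸ U` is generated by `z` of order `q² - 1` and `w` of infinite order with `w z w⁻¹ = z ^ q`:
if the `ℂˣ`-cover splits over a subgroup containing `z` and `w²`, then it splits. -/
theorem TwoFoldCover.extensionSplits_complexProj [IsTopologicalGroup G] (c : TwoFoldCover G E)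
    (U : Subgroup G) (hUn : U.Normal)
    (hU : ∀ W ∈ 𝓝 (1 : G), ∃ V : Subgroup G, V.Normal ∧ (V : Set G) ∈ 𝓝 1 ∧ V ≤ U ∧
      (V : Set G) ⊆ W ∧ Odd (V.relIndex U)) {z w : G} {q : ℕ} (hq : 1 < q)
    (hgen : ∀ g, ∃ i k : ℤ, g⁻¹ * (z ^ i * w ^ k) ∈ U)
    (hord : ∀ i k : ℤ, z ^ i * w ^ k ∈ U → k = 0 ∧ (((q - 1) * (q + 1) : ℕ) : ℤ) ∣ i)
    (hz : z ^ ((q - 1) * (q + 1)) ∈ U) (hw : (w * z * w⁻¹)⁻¹ * z ^ q ∈ U)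
    (A : Subgroup G) (hzA : z ∈ A) (hwA : w ^ 2 ∈ A) (hzw : Commute z (w ^ 2))
    (hA : ExtensionSplitsOver c.complexProj A) : ExtensionSplits c.complexProj := by
  obtain ⟨S, hSn, hSU, hSinj, s, hsc, hs1, hs⟩ := c.exists_normal_lift U hUn hU
  obtain ⟨r, hr⟩ := hA
  set S' : Subgroup c.ComplexTotal := S.map c.toComplex with hS'
  have hS'n : S'.Normal := by
    refine ⟨?_⟩
    rintro _ ⟨x, hx, rfl⟩ g
    obtain ⟨⟨y, e⟩, rfl⟩ := QuotientGroup.mk_surjective g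
    refine ⟨y * x * y⁻¹, hSn.conj_mem x hx y, ?_⟩
    rw [c.mk_eq_mul, mul_assoc (c.toComplex y), (c.commute_complexIncl e _).eq]
    simp [mul_assoc]
  have hS'inj : ∀ t ∈ S', c.complexProj t = 1 → t = 1 := by
    rintro _ ⟨x, hx, rfl⟩ h
    rw [hSinj x hx h, map_one]
  have hS'U : ∀ t ∈ S', c.complexProj t ∈ U := by
    rintro _ ⟨x, hx, rfl⟩
    rw [← hSU]
    exact ⟨x, hx, rfl⟩
  have hUS' : ∀ u ∈ U, ∃ t ∈ S', c.complexProj t = u := by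
    intro u hu
    rw [← hSU] at hu
    obtain ⟨x, hx, rfl⟩ := hu
    exact ⟨_, ⟨x, hx, rfl⟩, rfl⟩
  let p : c.ComplexTotal ⧸ S' →* G ⧸ U := QuotientGroup.map S' U c.complexProj hS'U
  have hp : ∀ t : c.ComplexTotal, p t = (c.complexProj t : G ⧸ U) := fun t => rfl
  let κ : ℂˣ →* c.ComplexTotal ⧸ S' := (QuotientGroup.mk' S').comp c.complexIncl
  obtain ⟨H, hH, hH'⟩ := exists_complement_of_commute p
    (by
      intro g
      obtain ⟨g, rfl⟩ := QuotientGroup.mk_surjective g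
      obtain ⟨t, rfl⟩ := c.complexProj_surjective g
      exact ⟨t, rfl⟩)
    κ
    (by
      rw [injective_iff_map_eq_one]
      intro e he
      have h1 : c.complexIncl e ∈ S' := (QuotientGroup.eq_one_iff _).1 he
      have h2 := hS'inj _ h1 (c.complexProj_complexIncl e)
      exact (injective_iff_map_eq_one _).1 c.complexIncl_injective e h2)
    (by
      ext t
      constructor
      · rintro ⟨e, rfl⟩
        change p (c.complexIncl e : c.ComplexTotal ⧸ S') = 1
        rw [hp, c.complexProj_complexIncl]; rfl
      · obtain ⟨t, rfl⟩ := QuotientGroup.mk_surjective t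
        intro h
        have h1 : c.complexProj t ∈ U := (QuotientGroup.eq_one_iff _).1 h
        obtain ⟨x, hx, hxt⟩ := hUS' _ h1
        have h3 : t * x⁻¹ ∈ c.complexProj.ker := by
          rw [MonoidHom.mem_ker, map_mul, map_inv, hxt, mul_inv_cancel]
        rw [← c.complexIncl_range] at h3
        obtain ⟨e, he⟩ := h3
        refine ⟨e, QuotientGroup.eq.2 ?_⟩
        rw [he]
        simpa using hx)
    (by
      rintro _ ⟨e, rfl⟩
      rw [Subgroup.mem_center_iff]
      intro t
      obtain ⟨t, rfl⟩ := QuotientGroup.mk_surjective t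
      exact congrArg QuotientGroup.mk (c.commute_complexIncl e t).eq.symm)
    (z := (z : G ⧸ U)) (w := (w : G ⧸ U)) hq
    (by
      intro y
      obtain ⟨g, rfl⟩ := QuotientGroup.mk_surjective y
      obtain ⟨i, k, h⟩ := hgen g
      exact ⟨i, k, QuotientGroup.eq.2 h⟩)
    (fun i k h => hord i k ((QuotientGroup.eq_one_iff _).1 h))
    ((QuotientGroup.eq_one_iff _).2 hz)
    (QuotientGroup.eq.2 hw)
    -- The only use of the splitting over A: its values at z and w² are commuting lifts.
    (a₀ := (r ⟨z, hzA⟩ : c.ComplexTotal ⧸ S')) (b₀ := (r ⟨w ^ 2, hwA⟩ : c.ComplexTotal ⧸ S'))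
    (by rw [hp, hr]) (by rw [hp, hr]; rfl)
    (by
      have h1 : Commute (⟨z, hzA⟩ : A) ⟨w ^ 2, hwA⟩ := Subtype.ext hzw
      exact (h1.map r).map (QuotientGroup.mk' S'))
  have hS'H : S' ≤ H.comap (QuotientGroup.mk' S') := by
    intro t ht
    change QuotientGroup.mk' S' t ∈ H
    rw [show QuotientGroup.mk' S' t = 1 from (QuotientGroup.eq_one_iff _).2 ht]
    exact one_mem H
  obtain ⟨σ, hσ, hσ'⟩ := exists_section_of_complement c.complexProj (H.comap (QuotientGroup.mk' S'))
    (by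
      intro t ht h
      refine hS'inj t ?_ h
      refine (QuotientGroup.eq_one_iff _).1 (hH _ ht ?_)
      change p (t : c.ComplexTotal ⧸ S') = 1
      rw [hp, h]; rfl)
    (by
      intro g
      obtain ⟨x, hx, hxg⟩ := hH' (g : G ⧸ U)
      obtain ⟨t, rfl⟩ := QuotientGroup.mk_surjective x
      rw [hp] at hxg
      obtain ⟨y, hy, hyt⟩ := hUS' _ (QuotientGroup.eq.1 hxg)
      refine ⟨t * y, mul_mem hx (hS'H hy), ?_⟩
      rw [map_mul, hyt, mul_inv_cancel_left])
  -- Near 1 the local section takes values in S, whose image lies in the complement, so σ coincides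
  -- with it there.
  have hσc : ContinuousAt σ 1 := by
    have h1 : ContinuousAt (fun x => c.toComplex (s x)) 1 :=
      c.continuous_toComplex.continuousAt.comp hsc
    refine h1.congr ?_
    filter_upwards [hs] with x hx
    have := hσ' (c.toComplex (s x)) (hS'H ⟨_, hx.1, rfl⟩)
    rw [c.complexProj_toComplex, hx.2] at this
    exact this.symm
  exact ⟨⟨σ, continuous_of_continuousAt_one σ hσc⟩, hσ⟩

/-- If a 2-fold cover splits over a subgroup, so does the `ℂˣ`-cover obtained from it. -/
theorem TwoFoldCover.extensionSplitsOver_complexProj (c : TwoFoldCover G E) {A : Subgroup G}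
    (h : ExtensionSplitsOver c.proj.toMonoidHom A) : ExtensionSplitsOver c.complexProj A := by
  obtain ⟨s, hs⟩ := h
  exact ⟨⟨c.toComplex.comp s.toMonoidHom, c.continuous_toComplex.comp s.continuous_toFun⟩, hs⟩

end Covers

/-! ### Squares and norm forms over the local field -/

section LocalField

open ValuativeRel IsLocalRing

variable {F : Type*} [Field F] [ValuativeRel F]

/-- Up to squares, every nonzero element is a unit or a uniformizer. -/
theorem exists_valuation_mul_sq {ϖ : F} (hϖ : ϖ ≠ 0)
    (hgen : ∀ x : F, x ≠ 0 → ∃ n : ℤ, valuation F x = valuation F ϖ ^ n) {d : F} (hd : d ≠ 0) :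
    ∃ t : F, t ≠ 0 ∧ (valuation F (d * t ^ 2) = 1 ∨ valuation F (d * t ^ 2) = valuation F ϖ) := by
  have hv : valuation F ϖ ≠ 0 := (Valuation.ne_zero_iff _).2 hϖ
  obtain ⟨n, hn⟩ := hgen d hd
  rcases Int.even_or_odd' n with ⟨k, rfl | rfl⟩
  · refine ⟨ϖ ^ (-k), zpow_ne_zero _ hϖ, Or.inl ?_⟩
    rw [map_mul, hn, map_pow, map_zpow₀, ← zpow_natCast, ← zpow_mul, ← zpow_add₀ hv]
    convert! zpow_zero _ using 2
    push_cast; ring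
  · refine ⟨ϖ ^ (-k), zpow_ne_zero _ hϖ, Or.inr ?_⟩
    rw [map_mul, hn, map_pow, map_zpow₀, ← zpow_natCast, ← zpow_mul, ← zpow_add₀ hv]
    convert! zpow_one _ using 2
    push_cast; ring

theorem valuation_le_uniformizer {ϖ : F} (hϖ : ϖ ≠ 0) (hϖ1 : valuation F ϖ < 1)
    (hgen : ∀ x : F, x ≠ 0 → ∃ n : ℤ, valuation F x = valuation F ϖ ^ n) {x : F}
    (hx : valuation F x < 1) : valuation F x ≤ valuation F ϖ := by
  have hv : 0 < valuation F ϖ := zero_lt_iff.2 ((Valuation.ne_zero_iff _).2 hϖ)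
  rcases eq_or_ne x 0 with rfl | hx0
  · rw [map_zero]; exact zero_le
  · obtain ⟨n, hn⟩ := hgen x hx0
    rw [hn, ← zpow_zero (valuation F ϖ), zpow_lt_zpow_iff_right_of_lt_one₀ hv hϖ1] at hx
    rw [hn]
    conv_rhs => rw [← zpow_one (valuation F ϖ)]
    rw [zpow_le_zpow_iff_right_of_lt_one₀ hv hϖ1]
    omega

variable [TopologicalSpace F] [IsNonarchimedeanLocalField F]

theorem residue_eq_zero_iff_valuation_lt_one (x : 𝒪[F]) :
    residue 𝒪[F] x = 0 ↔ valuation F x < 1 := by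
  rw [residue_eq_zero_iff, mem_maximalIdeal, mem_nonunits_iff,
    Valuation.Integer.not_isUnit_iff_valuation_lt_one]

theorem residue_ne_zero_iff_valuation_eq_one (x : 𝒪[F]) :
    residue 𝒪[F] x ≠ 0 ↔ valuation F x = 1 := by
  rw [ne_eq, residue_eq_zero_iff_valuation_lt_one, not_lt]
  exact ⟨fun h => le_antisymm x.2 h, fun h => h.ge⟩

theorem residue_two_ne_zero (hF : ringChar 𝓀[F] ≠ 2) : (2 : 𝓀[F]) ≠ 0 :=
  Ring.two_ne_zero hF

theorem valuation_two_eq_one (hF : ringChar 𝓀[F] ≠ 2) : valuation F 2 = 1 :=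
  (residue_ne_zero_iff_valuation_eq_one (2 : 𝒪[F])).1 (by
    rw [map_ofNat]; exact residue_two_ne_zero hF)

theorem two_ne_zero_of_residue (hF : ringChar 𝓀[F] ≠ 2) : (2 : F) ≠ 0 := by
  intro h
  have := valuation_two_eq_one hF
  rw [h, map_zero] at this
  exact zero_ne_one this

/-- Hensel's lemma for square roots of units, in odd residue characteristic. -/
theorem exists_mul_self_of_residue (hF : ringChar 𝓀[F] ≠ 2) {d : 𝒪[F]} {y : 𝓀[F]} (hy : y ≠ 0)
    (h : residue 𝒪[F] d = y * y) : ∃ a : 𝒪[F], d = a * a := by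
  let := IsTopologicalAddGroup.rightUniformSpace F
  have := isUniformAddGroup_of_addCommGroup (G := F)
  obtain ⟨a₀, rfl⟩ := residue_surjective y
  have hder : Polynomial.eval a₀ (Polynomial.derivative (Polynomial.X ^ 2 - Polynomial.C d)) =
      2 * a₀ := by
    simp [one_add_one_eq_two]
  obtain ⟨a, ha, -⟩ := HenselianRing.is_henselian (I := 𝓂[F])
    (Polynomial.X ^ 2 - Polynomial.C d) (Polynomial.monic_X_pow_sub_C d two_ne_zero) a₀
    (by
      rw [← residue_eq_zero_iff]
      simp [h, pow_two])
    (by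
      rw [hder]
      refine IsUnit.mk0 (G₀ := 𝓀[F]) _ ?_
      change residue 𝒪[F] (2 * a₀) ≠ 0
      rw [map_mul, map_ofNat]
      exact mul_ne_zero (residue_two_ne_zero hF) hy)
  refine ⟨a, ?_⟩
  simp only [Polynomial.IsRoot, Polynomial.eval_sub, Polynomial.eval_pow, Polynomial.eval_X,
    Polynomial.eval_C] at ha
  rw [← pow_two, sub_eq_zero.1 ha]

variable (F) in
/-- The value group is infinite cyclic. -/
theorem exists_uniformizer : ∃ ϖ : F, ϖ ≠ 0 ∧ valuation F ϖ < 1 ∧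
    ∀ x : F, x ≠ 0 → ∃ n : ℤ, valuation F x = valuation F ϖ ^ n := by
  obtain ⟨ϖ, hϖ⟩ := IsDiscreteValuationRing.exists_irreducible 𝒪[F]
  have hϖ0 : (ϖ : F) ≠ 0 := fun h => hϖ.ne_zero (Subtype.ext h)
  refine ⟨ϖ, hϖ0, Valuation.Integer.not_isUnit_iff_valuation_lt_one.1 hϖ.not_isUnit,
    fun x hx => ?_⟩
  obtain ⟨n, u, hu⟩ := IsDiscreteValuationRing.exists_units_eq_smul_zpow_of_irreducible hϖ hx
  refine ⟨n, ?_⟩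
  have hu1 : valuation F ((u : 𝒪[F]) : F) = 1 :=
    (Valuation.integer.integers (valuation F)).one_of_isUnit u.isUnit
  have hx' : x = ((u : 𝒪[F]) : F) * (ϖ : F) ^ n := hu
  rw [hx', map_mul, hu1, one_mul, map_zpow₀]

/-- The norm form of the unramified quadratic extension. -/
theorem valuation_sq_sub_mul_sq {ε : 𝒪[F]} (hε : ∀ y : 𝓀[F], residue 𝒪[F] ε ≠ y * y) (a b : F) :
    valuation F (a * a - ε * (b * b)) =
      max (valuation F a * valuation F a) (valuation F b * valuation F b) := by
  let v := valuation F
  -- A zero residue would exhibit ε as a square. The general case follows by dividing by the larger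
  -- of a and b.
  have key : ∀ c : 𝒪[F], v (1 - ε * (c * c)) = 1 := fun c => by
    refine (residue_ne_zero_iff_valuation_eq_one (1 - ε * (c * c))).1 fun h => ?_
    simp only [map_sub, map_one, map_mul] at h
    have hc : residue 𝒪[F] c ≠ 0 := fun hc => by simp [hc] at h
    refine hε (residue 𝒪[F] c)⁻¹ ?_
    field_simp
    linear_combination -h
  have key' : ∀ c : 𝒪[F], v (c * c - ε) = 1 := fun c => by
    refine (residue_ne_zero_iff_valuation_eq_one (c * c - ε)).1 fun h => ?_
    simp only [map_sub, map_mul] at h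
    exact hε (residue 𝒪[F] c) (sub_eq_zero.1 h).symm
  rcases le_total (v b) (v a) with h | h
  · rw [max_eq_left (mul_le_mul' h h)]
    rcases eq_or_ne a 0 with rfl | ha
    · rw [map_zero, le_zero_iff, map_eq_zero] at h
      simp [h]
    · have hc : v (b / a) ≤ 1 := by
        rw [map_div₀]
        exact div_le_one_of_le₀ h zero_le
      have := key ⟨b / a, hc⟩
      rw [show a * a - ε * (b * b) = a * a * (1 - ε * (b / a * (b / a))) by field_simp,
        map_mul, map_mul, this, mul_one]
  · rw [max_eq_right (mul_le_mul' h h)]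
    rcases eq_or_ne b 0 with rfl | hb
    · rw [map_zero, le_zero_iff, map_eq_zero] at h
      simp [h]
    · have hc : v (a / b) ≤ 1 := by
        rw [map_div₀]
        exact div_le_one_of_le₀ h zero_le
      have := key' ⟨a / b, hc⟩
      rw [show a * a - ε * (b * b) = b * b * (a / b * (a / b) - ε) by field_simp,
        map_mul, map_mul, this, mul_one]

/-- Units of odd residue characteristic are represented by the form `a² - ε b²`. -/
theorem exists_sq_eq_mul_sq_add (hF : ringChar 𝓀[F] ≠ 2) {ε π : 𝒪[F]}
    (hε : residue 𝒪[F] ε ≠ 0) (hπ : residue 𝒪[F] π ≠ 0) :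
    ∃ a b : 𝒪[F], a * a = ε * (b * b) + π := by
  classical
  have := Fintype.ofFinite 𝓀[F]
  obtain ⟨x, y, hxy⟩ := FiniteField.exists_root_sum_quadratic (R := 𝓀[F])
    (f := Polynomial.X ^ 2)
    (g := Polynomial.C (-residue 𝒪[F] ε) * Polynomial.X ^ 2 + Polynomial.C 0 * Polynomial.X +
      Polynomial.C (-residue 𝒪[F] π))
    (by simp) (Polynomial.degree_quadratic (neg_ne_zero.2 hε)) (FiniteField.odd_card_of_char_ne_two hF)
  simp only [Polynomial.eval_pow, Polynomial.eval_X, Polynomial.eval_add, Polynomial.eval_mul,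
    Polynomial.eval_C, zero_mul, add_zero] at hxy
  -- The residue equation is x² = ε y² + π. Hensel needs a nonzero root: lift y if x = 0, and x
  -- otherwise.
  rcases eq_or_ne x 0 with rfl | hx
  · have hy : y ≠ 0 := by
      rintro rfl
      simp [hπ] at hxy
    have hεu : IsUnit ε := (residue_ne_zero_iff_isUnit ε).1 hε
    obtain ⟨e, rfl⟩ := hεu
    obtain ⟨b, hb⟩ := exists_mul_self_of_residue hF (d := -π * (↑e⁻¹ : 𝒪[F])) hy (by
      have h1 : residue 𝒪[F] e * residue 𝒪[F] (↑e⁻¹ : 𝒪[F]) = 1 := by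
        rw [← map_mul, Units.mul_inv, map_one]
      rw [map_mul, map_neg]
      linear_combination (residue 𝒪[F] (↑e⁻¹ : 𝒪[F])) * hxy + y ^ 2 * h1)
    refine ⟨0, b, ?_⟩
    rw [← hb]
    linear_combination π * e.mul_inv
  · obtain ⟨b, rfl⟩ := residue_surjective y
    obtain ⟨a, ha⟩ := exists_mul_self_of_residue hF (d := ε * (b * b) + π) hx (by
      simp only [map_add, map_mul]
      linear_combination -hxy)
    exact ⟨a, b, ha.symm⟩

end LocalField

/-! ### The unramified quadratic extension -/

section QuadraticExtension

/-- In characteristic different from two a quadratic extension is generated by a square root. -/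
theorem exists_mul_self_eq_algebraMap_of_finrank_eq_two {F M : Type*} [Field F] [Field M]
    [Algebra F M] (h2 : (2 : F) ≠ 0) (hM : Module.finrank F M = 2) :
    ∃ (α : M) (d : F), α * α = algebraMap F M d ∧ ∀ a, algebraMap F M a ≠ α := by
  obtain ⟨x, hx⟩ : ∃ x : M, ∀ a, algebraMap F M a ≠ x := by
    by_contra! h
    have : (⊥ : Subalgebra F M) = ⊤ := by
      rw [eq_top_iff]
      exact fun x _ => Algebra.mem_bot.2 (h x)
    rw [Subalgebra.bot_eq_top_iff_finrank_eq_one, hM] at this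
    omega
  have : FiniteDimensional F M := FiniteDimensional.of_finrank_pos (by omega)
  have hli : LinearIndependent F ![1, x] := by
    rw [LinearIndependent.pair_iff' one_ne_zero]
    intro a ha
    exact hx a (by rw [Algebra.algebraMap_eq_smul_one, ha])
  have hspan := hli.span_eq_top_of_card_eq_finrank' (by rw [hM]; rfl)
  have hmem : x * x ∈ Submodule.span F (Set.range ![1, x]) := hspan ▸ Submodule.mem_top
  rw [Matrix.range_cons_cons_empty, Submodule.mem_span_pair] at hmem
  obtain ⟨c, b, hcb⟩ := hmem
  rw [← Algebra.algebraMap_eq_smul_one, Algebra.smul_def] at hcb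
  -- Completing the square in x² = c + b x.
  refine ⟨x - algebraMap F M (b / 2), c + (b / 2) * (b / 2), ?_, fun a ha => ?_⟩
  · have hb : algebraMap F M b = 2 * algebraMap F M (b / 2) := by
      rw [← map_ofNat (algebraMap F M) 2, ← map_mul, mul_div_cancel₀ _ h2]
    rw [map_add, map_mul]
    linear_combination -hcb + x * hb
  · exact hx (a + b / 2) (by rw [map_add, ha]; ring)

/-- A minimal polynomial has degree 1 or 2, so the leading coefficient of its derivative is nonzero.
This is needed for finiteness of the integral closure. -/
theorem isSeparable_of_finrank_eq_two {F M : Type*} [Field F] [Field M]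
    [Algebra F M] (h2 : (2 : F) ≠ 0) (hM : Module.finrank F M = 2) : Algebra.IsSeparable F M := by
  have : FiniteDimensional F M := FiniteDimensional.of_finrank_pos (by omega)
  refine ⟨fun x => ?_⟩
  have h_int : IsIntegral F x := IsIntegral.of_finite F x
  have hirr := minpoly.irreducible h_int
  refine (Polynomial.separable_iff_derivative_ne_zero hirr).2 fun h => ?_
  have hdvd : (minpoly F x).natDegree ∣ 2 := hM ▸ minpoly.degree_dvd h_int
  have hpos := minpoly.natDegree_pos h_int
  have hc := congrArg (fun f => Polynomial.coeff f ((minpoly F x).natDegree - 1)) h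
  simp only [Polynomial.coeff_derivative, Polynomial.coeff_zero] at hc
  rw [Nat.sub_add_cancel hpos, (minpoly.monic h_int).coeff_natDegree, one_mul] at hc
  have hle := Nat.le_of_dvd (by norm_num) hdvd
  obtain h1 | h1 : (minpoly F x).natDegree = 1 ∨ (minpoly F x).natDegree = 2 := by omega
  · rw [h1] at hc; norm_num at hc
  · rw [h1] at hc; norm_num at hc; exact h2 (by linear_combination hc)

-- The residue field tensored with N is N/𝔪N.
open TensorProduct in
theorem mem_maximalIdeal_smul_of_one_tmul_eq_zero {R N : Type*} [CommRing R] [IsLocalRing R]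
    [AddCommGroup N] [Module R N] {x : N}
    (h : (1 : IsLocalRing.ResidueField R) ⊗ₜ[R] x = 0) :
    x ∈ (IsLocalRing.maximalIdeal R • ⊤ : Submodule R N) := by
  have := congrArg (TensorProduct.quotTensorEquivQuotSMul N (IsLocalRing.maximalIdeal R)) h
  exact (Submodule.Quotient.mk_eq_zero _).1
    ((TensorProduct.quotTensorEquivQuotSMul_mk_one_tmul _ x).symm.trans (this.trans
      (map_zero (TensorProduct.quotTensorEquivQuotSMul N (IsLocalRing.maximalIdeal R)))))

open ValuativeRel IsLocalRing

variable {F : Type*} [Field F] [ValuativeRel F] [TopologicalSpace F] [IsNonarchimedeanLocalField F]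
  {M : Type*} [Field M] [Algebra F M]

open TensorProduct in
/-- An unramified extension contains no square root of a uniformizer. -/
theorem IsUnramifiedExtension.mul_self_ne_uniformizer (hF : ringChar 𝓀[F] ≠ 2)
    (hM : Module.finrank F M = 2) (hM' : IsUnramifiedExtension F M) {ϖ π : F} (hϖ : ϖ ≠ 0)
    (hϖ1 : valuation F ϖ < 1)
    (hgen : ∀ x : F, x ≠ 0 → ∃ n : ℤ, valuation F x = valuation F ϖ ^ n)
    (hπ : valuation F π = valuation F ϖ) (α : M) : α * α ≠ algebraMap F M π := by
  intro hα
  have hFD : FiniteDimensional F M := FiniteDimensional.of_finrank_pos (by omega)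
  have hsep := isSeparable_of_finrank_eq_two (two_ne_zero_of_residue hF) hM
  have hfin : Module.Finite 𝒪[F] (integralClosure 𝒪[F] M) :=
    IsIntegralClosure.finite 𝒪[F] F M (integralClosure 𝒪[F] M)
  have hunr : Algebra.FormallyUnramified 𝒪[F] (integralClosure 𝒪[F] M) := hM'
  have hπ1 : valuation F π < 1 := hπ ▸ hϖ1
  have hπ0 : π ≠ 0 := by
    rintro rfl
    rw [map_zero] at hπ
    exact hϖ ((Valuation.zero_iff _).1 hπ.symm)
  let π' : 𝒪[F] := ⟨π, hπ1.le⟩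
  have hαα : α * α = algebraMap 𝒪[F] M π' := hα
  have hαi : IsIntegral 𝒪[F] α := by
    refine IsIntegral.of_pow (n := 2) two_pos ?_
    rw [pow_two, hαα]
    exact isIntegral_algebraMap
  let α' : integralClosure 𝒪[F] M := ⟨α, hαi⟩
  have hα' : α' * α' = algebraMap 𝒪[F] (integralClosure 𝒪[F] M) π' := Subtype.ext hαα
  have hred : IsReduced (𝓀[F] ⊗[𝒪[F]] integralClosure 𝒪[F] M) :=
    Algebra.FormallyUnramified.isReduced_of_field 𝓀[F] _
  have hmax : 𝓂[F] = Ideal.span {π'} := by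
    ext x
    rw [Ideal.mem_span_singleton, ← residue_eq_zero_iff, residue_eq_zero_iff_valuation_lt_one]
    constructor
    · intro hx
      refine (Valuation.integer.integers (valuation F)).dvd_of_le ?_
      change valuation F x ≤ valuation F π
      rw [hπ]
      exact valuation_le_uniformizer hϖ hϖ1 hgen hx
    · rintro ⟨y, rfl⟩
      change valuation F (π * y) < 1
      rw [map_mul]
      exact mul_lt_one_of_lt_of_le hπ1 y.2
  -- Unramifiedness makes the special fibre reduced. There α' has square zero, so it vanishes, and α
  -- = πβ with β integral and β² = π⁻¹, which is absurd.
  have hzero : (1 : 𝓀[F]) ⊗ₜ[𝒪[F]] α' = 0 := by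
    refine hred.eq_zero _ ⟨2, ?_⟩
    rw [pow_two, Algebra.TensorProduct.tmul_mul_tmul, hα', Algebra.algebraMap_eq_smul_one,
      TensorProduct.tmul_smul, TensorProduct.smul_tmul', mul_one, Algebra.smul_def, mul_one]
    have : algebraMap 𝒪[F] 𝓀[F] π' = 0 := (residue_eq_zero_iff_valuation_lt_one π').2 hπ1
    rw [this, TensorProduct.zero_tmul]
  have hmem : α' ∈ (𝓂[F] • ⊤ : Submodule 𝒪[F] (integralClosure 𝒪[F] M)) :=
    mem_maximalIdeal_smul_of_one_tmul_eq_zero hzero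
  rw [hmax, Submodule.ideal_span_singleton_smul] at hmem
  obtain ⟨β, -, hβ⟩ := hmem
  have hβ' : algebraMap F M π * (β : M) = α := by
    rw [← Algebra.smul_def]
    exact congrArg Subtype.val hβ
  have h_int : IsIntegral 𝒪[F] (π⁻¹ : F) := by
    have h1 : IsIntegral 𝒪[F] ((β : M) * β) := β.2.mul β.2
    have h2 : (β : M) * β = algebraMap F M π⁻¹ := by
      have h0 : algebraMap F M π ≠ 0 := (map_ne_zero _).2 hπ0
      rw [← hβ'] at hα
      rw [map_inv₀]
      field_simp
      refine mul_left_cancel₀ h0 ?_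
      linear_combination hα
    rw [h2] at h1
    exact (isIntegral_algebraMap_iff (algebraMap F M).injective).1 h1
  obtain ⟨y, hy⟩ := IsIntegrallyClosed.isIntegral_iff.1 h_int
  have : valuation F π⁻¹ ≤ 1 := hy ▸ y.2
  rw [map_inv₀, inv_le_one₀ (zero_lt_iff.2 ((Valuation.ne_zero_iff _).2 hπ0))] at this
  exact absurd hπ1 this.not_gt

/-- The unramified quadratic extension is generated by a square root of a unit which is not a
square in the residue field. -/
theorem IsUnramifiedExtension.exists_sqrt_unit (hF : ringChar 𝓀[F] ≠ 2)
    (hM : Module.finrank F M = 2) (hM' : IsUnramifiedExtension F M) :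
    ∃ (α : M) (ε : 𝒪[F]), α * α = algebraMap F M ε ∧ (∀ a, algebraMap F M a ≠ α) ∧
      ∀ y : 𝓀[F], residue 𝒪[F] ε ≠ y * y := by
  obtain ⟨ϖ, hϖ, hϖ1, hgen⟩ := exists_uniformizer F
  obtain ⟨α, d, hα, hαF⟩ :=
    exists_mul_self_eq_algebraMap_of_finrank_eq_two (two_ne_zero_of_residue hF) hM
  have hd : d ≠ 0 := by
    rintro rfl
    rw [map_zero, mul_self_eq_zero] at hα
    exact hαF 0 (by rw [map_zero, hα])
  obtain ⟨t, ht, h⟩ := exists_valuation_mul_sq hϖ hgen hd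
  have ht' : algebraMap F M t ≠ 0 := (map_ne_zero _).2 ht
  have hsq : α * algebraMap F M t * (α * algebraMap F M t) = algebraMap F M (d * t ^ 2) := by
    rw [map_mul, map_pow, ← hα]; ring
  -- In the unit case a square residue would put α in F by Hensel; the uniformizer case contradicts
  -- unramifiedness.
  rcases h with h | h
  · refine ⟨α * algebraMap F M t, ⟨d * t ^ 2, h.le⟩, hsq, fun a ha => ?_, fun y hy => ?_⟩
    · refine hαF (a / t) ?_
      rw [map_div₀, ha, mul_div_cancel_right₀ _ ht']
    · have hne := (residue_ne_zero_iff_valuation_eq_one ⟨d * t ^ 2, h.le⟩).2 h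
      have hy0 : y ≠ 0 := by
        rintro rfl
        exact hne (by simpa using hy)
      obtain ⟨a, ha⟩ := exists_mul_self_of_residue hF hy0 hy
      have ha' : d * t ^ 2 = a * a := congrArg Subtype.val ha
      rw [ha', map_mul] at hsq
      rcases mul_self_eq_mul_self_iff.1 hsq with h1 | h1
      · refine hαF (a / t) ?_
        rw [map_div₀, ← h1, mul_div_cancel_right₀ _ ht']
      · refine hαF (-a / t) ?_
        rw [map_div₀, map_neg, ← h1, mul_div_cancel_right₀ _ ht']
  · exact absurd hsq (hM'.mul_self_ne_uniformizer hF hM hϖ hϖ1 hgen h _)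

end QuadraticExtension

/-! ### Generators of the quaternion algebra -/

section QuaternionStructure

variable {F D : Type*} [Field F] [DivisionRing D] [Algebra F D]

/-- The standard basis of a quaternion algebra is linearly independent. -/
theorem linearIndependent_quaternion (h2 : (2 : F) ≠ 0) {α j : D}
    (hαF : ∀ a, algebraMap F D a ≠ α) (hj : j ≠ 0) (hαj : j * α = -(α * j)) :
    LinearIndependent F ![1, α, j, α * j] := by
  have hα0 : α ≠ 0 := fun h => hαF 0 (by rw [map_zero, h])
  have h2D : (2 : D) ≠ 0 := by
    rw [← map_ofNat (algebraMap F D) 2]; exact (map_ne_zero _).2 h2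
  have hpair : ∀ a b : F, a • (1 : D) + b • α = 0 → a = 0 ∧ b = 0 := by
    have hli : LinearIndependent F ![1, α] := by
      rw [LinearIndependent.pair_iff' one_ne_zero]
      intro a ha
      exact hαF a (by rw [Algebra.algebraMap_eq_smul_one, ha])
    exact LinearIndependent.pair_iff.1 hli
  rw [Fintype.linearIndependent_iff]
  intro g hg
  simp only [Fin.sum_univ_four, Matrix.cons_val] at hg
  set m := g 0 • (1 : D) + g 1 • α with hm
  set n := g 2 • (1 : D) + g 3 • α with hn
  have hmn : m + n * j = 0 := by
    rw [← hg, hm, hn]; simp only [add_mul, smul_mul_assoc, one_mul]; abel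
  have hmα : α * m = m * α := by
    rw [hm]; simp [mul_add, add_mul]
  have hnα : α * n = n * α := by
    rw [hn]; simp [mul_add, add_mul]
  clear_value m n
  -- The commutator with α kills m and doubles the nj part.
  have h1 : α * (m + n * j) - (m + n * j) * α = 2 * (α * (n * j)) := by
    rw [mul_add, add_mul, hmα, mul_assoc n j α, hαj, mul_neg, ← mul_assoc n α j, ← hnα]
    simp only [mul_assoc, two_mul]; abel
  rw [hmn, mul_zero, zero_mul, sub_zero] at h1
  have h2' : n = 0 := by
    simpa [h2D, hα0, hj] using h1.symm
  have h3 : m = 0 := by rwa [h2', zero_mul, add_zero] at hmn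
  have h4 := hpair _ _ (hm ▸ h3)
  have h5 := hpair _ _ (hn ▸ h2')
  intro i
  fin_cases i
  · exact h4.1
  · exact h4.2
  · exact h5.1
  · exact h5.2

/-- Elements anticommuting with `α` have central square. -/
theorem exists_mul_self_eq_of_anticommute [Algebra.IsCentral F D] (hD : Module.finrank F D = 4)
    (h2 : (2 : F) ≠ 0) {α j : D} (hαF : ∀ a, algebraMap F D a ≠ α)
    (hj : j ≠ 0) (hαj : j * α = -(α * j)) : ∃ π : F, j * j = algebraMap F D π := by
  have : FiniteDimensional F D := FiniteDimensional.of_finrank_pos (by omega)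
  have hspan := (linearIndependent_quaternion h2 hαF hj hαj).span_eq_top_of_card_eq_finrank'
    (by rw [hD]; rfl)
  have hc1 : Commute (j * j) α := by
    change j * j * α = α * (j * j)
    rw [mul_assoc, hαj, mul_neg, ← mul_assoc, hαj, neg_mul, neg_neg, mul_assoc]
  have hc2 : Commute (j * j) j := by
    change j * j * j = j * (j * j)
    rw [mul_assoc]
  have hcen : j * j ∈ Subalgebra.center F D := by
    rw [Subalgebra.mem_center_iff]
    intro x
    have hx : x ∈ Submodule.span F (Set.range ![1, α, j, α * j]) := hspan ▸ Submodule.mem_top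
    induction hx using Submodule.span_induction with
    | mem x hx =>
      obtain ⟨i, rfl⟩ := hx
      fin_cases i
      · exact (Commute.one_right (j * j)).eq.symm
      · exact hc1.eq.symm
      · exact hc2.eq.symm
      · exact (hc1.mul_right hc2).eq.symm
    | zero => simp
    | add x y _ _ hx hy => rw [add_mul, mul_add, hx, hy]
    | smul a x _ hx => rw [smul_mul_assoc, mul_smul_comm, hx]
  obtain ⟨π, hπ⟩ := Algebra.mem_bot.1 (Algebra.IsCentral.out hcen)
  exact ⟨π, hπ.symm⟩

open ValuativeRel IsLocalRing

/-- A quaternion division algebra over a local field is obtained from the unramified quadratic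
extension by adjoining a square root `j` of a uniformizer which anticommutes with `α`. -/
theorem exists_anticommute_uniformizer [ValuativeRel F] [TopologicalSpace F]
    [IsNonarchimedeanLocalField F] (hF : ringChar 𝓀[F] ≠ 2) [Algebra.IsCentral F D]
    (hD : Module.finrank F D = 4) {α : D} {ε : 𝒪[F]} (hα : α * α = algebraMap F D ε)
    (hαF : ∀ a, algebraMap F D a ≠ α) (hε : ∀ y : 𝓀[F], residue 𝒪[F] ε ≠ y * y)
    {ϖ : F} (hϖ : ϖ ≠ 0)
    (hgen : ∀ x : F, x ≠ 0 → ∃ n : ℤ, valuation F x = valuation F ϖ ^ n) :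
    ∃ (j : D) (π : F), j ≠ 0 ∧ j * α = -(α * j) ∧ j * j = algebraMap F D π ∧
      valuation F π = valuation F ϖ := by
  have h2 := two_ne_zero_of_residue hF
  obtain ⟨x, hx⟩ : ∃ x, α * x ≠ x * α := by
    by_contra! h
    have hcen : α ∈ Subalgebra.center F D := by
      rw [Subalgebra.mem_center_iff]
      exact fun x => (h x).symm
    obtain ⟨a, ha⟩ := Algebra.mem_bot.1 (Algebra.IsCentral.out hcen)
    exact hαF a ha
  -- A commutator with α anticommutes with α because α² is central.
  have hj : α * x - x * α ≠ 0 := sub_ne_zero.2 hx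
  have hjα : (α * x - x * α) * α = -(α * (α * x - x * α)) := by
    rw [sub_mul, mul_sub, mul_assoc x α α, ← mul_assoc α α x, hα, Algebra.commutes ε.1 x]
    simp only [mul_assoc]; abel
  set j := α * x - x * α
  obtain ⟨π, hπ⟩ := exists_mul_self_eq_of_anticommute hD h2 hαF hj hjα
  have hπ0 : π ≠ 0 := by
    rintro rfl
    rw [map_zero, mul_self_eq_zero] at hπ
    exact hj hπ
  obtain ⟨t, ht, h⟩ := exists_valuation_mul_sq hϖ hgen hπ0
  have htj : t • j ≠ 0 := smul_ne_zero ht hj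
  have htα : (t • j) * α = -(α * (t • j)) := by
    rw [smul_mul_assoc, hjα, mul_smul_comm, smul_neg]
  have htπ : (t • j) * (t • j) = algebraMap F D (π * t ^ 2) := by
    rw [smul_mul_smul_comm, hπ, Algebra.smul_def, ← map_mul]
    congr 1; ring
  rcases h with h | h
  -- If the square were a unit, it would be a² - ε b², so (bα + tj)² = a² and bα + tj = ±a in a
  -- division ring, against independence of the basis.
  · exfalso
    have hπ' := (residue_ne_zero_iff_valuation_eq_one (F := F) ⟨π * t ^ 2, h.le⟩).2 h
    obtain ⟨a, b, hab⟩ := exists_sq_eq_mul_sq_add hF (by simpa using hε 0) hπ'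
    have hab' : (a : F) * a = ε * (b * b) + π * t ^ 2 := congrArg Subtype.val hab
    have hw : ((b : F) • α + t • j) * ((b : F) • α + t • j) =
        algebraMap F D a * algebraMap F D a := by
      rw [← map_mul, hab', map_add, ← htπ, add_mul, mul_add, mul_add, mul_smul_comm (b : F) (t • j),
        htα, smul_mul_smul_comm, hα, Algebra.smul_def, ← map_mul, smul_mul_assoc, smul_neg,
        mul_comm ((b : F) * b)]
      abel
    have hli := linearIndependent_quaternion h2 hαF htj htα
    rw [Fintype.linearIndependent_iff] at hli
    have hcomm : Commute ((b : F) • α + t • j) (algebraMap F D a) := Algebra.commute_algebraMap_right _ _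
    rcases hcomm.mul_self_eq_mul_self_iff.1 hw with h1 | h1
    · have := hli ![-(a : F), b, 1, 0] (by
        simp [Fin.sum_univ_four, ← Algebra.algebraMap_eq_smul_one]
        rw [← h1]; abel) 2
      simp at this
    · have := hli ![(a : F), b, 1, 0] (by
        simp [Fin.sum_univ_four, ← Algebra.algebraMap_eq_smul_one]
        rw [← neg_eq_iff_eq_neg.2 h1]; abel) 2
      simp at this
  · exact ⟨t • j, π * t ^ 2, htj, htα, htπ, h⟩

end QuaternionStructure

/-! ### The valuation given by the reduced norm -/

section QuaternionValuation

open ValuativeRel IsLocalRing Quaternion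

variable {F : Type*} [Field F]

/-- The reduced norm of a quaternion algebra. -/
def quaternionNorm (ε π : F) : ℍ[F,ε,0,π] →*₀ F where
  toFun x := x.re * x.re - ε * (x.imI * x.imI) - π * (x.imJ * x.imJ - ε * (x.imK * x.imK))
  map_zero' := by simp
  map_one' := by simp
  map_mul' x y := by
    simp only [QuaternionAlgebra.re_mul, QuaternionAlgebra.imI_mul, QuaternionAlgebra.imJ_mul,
      QuaternionAlgebra.imK_mul]
    ring

variable [ValuativeRel F] [TopologicalSpace F] [IsNonarchimedeanLocalField F]

/-- Nonzero values of a² - ε b² have even valuation, so the two terms of the reduced norm have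
valuations of opposite parity and cannot cancel. -/
theorem valuation_quaternionNorm {ε : 𝒪[F]} (hε : ∀ y : 𝓀[F], residue 𝒪[F] ε ≠ y * y)
    {ϖ π : F} (hϖ : ϖ ≠ 0) (hϖ1 : valuation F ϖ < 1)
    (hgen : ∀ x : F, x ≠ 0 → ∃ n : ℤ, valuation F x = valuation F ϖ ^ n)
    (hπ : valuation F π = valuation F ϖ) (x : ℍ[F,(ε : F),0,π]) :
    valuation F (quaternionNorm (ε : F) π x) =
      max (max (valuation F x.re * valuation F x.re) (valuation F x.imI * valuation F x.imI))
        (valuation F π *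
          max (valuation F x.imJ * valuation F x.imJ) (valuation F x.imK * valuation F x.imK)) := by
  have hv : 0 < valuation F ϖ := zero_lt_iff.2 ((Valuation.ne_zero_iff _).2 hϖ)
  have hmax : ∀ a b : F, max (valuation F a * valuation F a) (valuation F b * valuation F b) = 0 ∨
      ∃ n : ℤ, max (valuation F a * valuation F a) (valuation F b * valuation F b) =
        valuation F ϖ ^ (2 * n) := by
    have hsq : ∀ a : F, valuation F a * valuation F a = 0 ∨
        ∃ n : ℤ, valuation F a * valuation F a = valuation F ϖ ^ (2 * n) := fun a => by
      rcases eq_or_ne a 0 with rfl | ha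
      · left; simp
      · obtain ⟨n, hn⟩ := hgen a ha
        exact Or.inr ⟨n, by rw [hn, two_mul, zpow_add₀ hv.ne']⟩
    intro a b
    rcases max_choice (valuation F a * valuation F a) (valuation F b * valuation F b) with h | h
    · rw [h]; exact hsq a
    · rw [h]; exact hsq b
  change valuation F (_ - _) = _
  rw [← valuation_sq_sub_mul_sq hε x.re x.imI, ← valuation_sq_sub_mul_sq hε x.imJ x.imK]
  have h1 := hmax x.re x.imI
  have h2 := hmax x.imJ x.imK
  rw [← valuation_sq_sub_mul_sq hε x.re x.imI] at h1
  rw [← valuation_sq_sub_mul_sq hε x.imJ x.imK] at h2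
  rw [← map_mul]
  rcases h1 with h1 | ⟨n, h1⟩
  · rw [h1, max_eq_right zero_le, (Valuation.zero_iff _).1 h1, zero_sub, Valuation.map_neg]
  rcases h2 with h2 | ⟨m, h2⟩
  · rw [(Valuation.zero_iff _).1 h2, mul_zero, sub_zero, map_zero, max_eq_left zero_le]
  have hne : valuation F (x.re * x.re - ε * (x.imI * x.imI)) ≠
      valuation F (π * (x.imJ * x.imJ - ε * (x.imK * x.imK))) := by
    rw [map_mul, h1, h2, hπ, ← zpow_one_add₀ hv.ne']
    intro h
    have := zpow_right_injective₀ hv hϖ1.ne h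
    omega
  rcases lt_or_gt_of_ne hne with h | h
  · rw [Valuation.map_sub_eq_of_lt_right _ h, max_eq_right h.le]
  · rw [Valuation.map_sub_eq_of_lt_left _ h, max_eq_left h.le]

/-- The valuation of a quaternion division algebra over a local field, in coordinates. -/
theorem exists_quaternion_valuation {D : Type*} [DivisionRing D] [Algebra F D]
    (hD : Module.finrank F D = 4) (h2 : (2 : F) ≠ 0)
    {ε : 𝒪[F]} (hε : ∀ y : 𝓀[F], residue 𝒪[F] ε ≠ y * y)
    {ϖ π : F} (hϖ : ϖ ≠ 0) (hϖ1 : valuation F ϖ < 1)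
    (hgen : ∀ x : F, x ≠ 0 → ∃ n : ℤ, valuation F x = valuation F ϖ ^ n)
    (hπ : valuation F π = valuation F ϖ) {α j : D} (hα : α * α = algebraMap F D ε)
    (hαF : ∀ a, algebraMap F D a ≠ α) (hj : j ≠ 0) (hαj : j * α = -(α * j))
    (hjj : j * j = algebraMap F D π) :
    ∃ W : Valuation D (ValueGroupWithZero F), ∀ a b c d : F,
      W (a • 1 + b • α + c • j + d • (α * j)) =
        max (max (valuation F a * valuation F a) (valuation F b * valuation F b))
          (valuation F π * max (valuation F c * valuation F c) (valuation F d * valuation F d)) := by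
  have : FiniteDimensional F D := FiniteDimensional.of_finrank_pos (by omega)
  let q : QuaternionAlgebra.Basis D (ε : F) 0 π :=
    { i := α
      j := j
      k := α * j
      i_mul_i := by rw [hα, Algebra.algebraMap_eq_smul_one]; simp
      j_mul_j := by rw [hjj, Algebra.algebraMap_eq_smul_one]
      i_mul_j := rfl
      j_mul_i := by rw [hαj]; simp }
  have hq : ∀ a b c d : F, q.liftHom ⟨a, b, c, d⟩ = a • 1 + b • α + c • j + d • (α * j) :=
    fun a b c d => by
      rw [← Algebra.algebraMap_eq_smul_one]; rfl
  have hli := linearIndependent_quaternion h2 hαF hj hαj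
  have hinj : Function.Injective q.liftHom := by
    rw [injective_iff_map_eq_zero]
    rintro ⟨a, b, c, d⟩ h
    rw [hq] at h
    have := Fintype.linearIndependent_iff.1 hli ![a, b, c, d] (by
      simpa [Fin.sum_univ_four] using h)
    exact QuaternionAlgebra.ext (this 0) (this 1) (this 2) (this 3)
  have hsurj : Function.Surjective q.liftHom :=
    (LinearMap.injective_iff_surjective_of_finrank_eq_finrank
      (f := q.liftHom.toLinearMap) (by rw [QuaternionAlgebra.finrank_eq_four, hD])).1 hinj
  let e := AlgEquiv.ofBijective q.liftHom ⟨hinj, hsurj⟩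
  -- Multiplicativity is that of the norm; the ultrametric inequality is read off the coordinate
  -- formula.
  let w : Valuation ℍ[F,(ε : F),0,π] (ValueGroupWithZero F) :=
    { (valuation F).toMonoidWithZeroHom.comp (quaternionNorm (ε : F) π) with
      map_add_le_max' := fun x y => by
        change valuation F (quaternionNorm (ε : F) π (x + y)) ≤
          max (valuation F (quaternionNorm (ε : F) π x)) (valuation F (quaternionNorm (ε : F) π y))
        have hadd : ∀ a b : F, valuation F (a + b) * valuation F (a + b) ≤
            max (valuation F a * valuation F a) (valuation F b * valuation F b) := fun a b => by
          rcases le_max_iff.1 ((valuation F).map_add a b) with h | h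
          · exact le_max_of_le_left (mul_le_mul' h h)
          · exact le_max_of_le_right (mul_le_mul' h h)
        simp only [valuation_quaternionNorm hε hϖ hϖ1 hgen hπ, QuaternionAlgebra.re_add,
          QuaternionAlgebra.imI_add, QuaternionAlgebra.imJ_add, QuaternionAlgebra.imK_add]
        refine max_le (max_le ((hadd _ _).trans ?_) ((hadd _ _).trans ?_)) ?_
        · exact max_le_max (le_max_of_le_left (le_max_left _ _))
            (le_max_of_le_left (le_max_left _ _))
        · exact max_le_max (le_max_of_le_left (le_max_right _ _))
            (le_max_of_le_left (le_max_right _ _))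
        · refine le_trans (mul_le_mul_right (max_le_max (hadd _ _) (hadd _ _)) _) ?_
          rw [max_max_max_comm, mul_max]
          exact max_le_max (le_max_right _ _) (le_max_right _ _) }
  refine ⟨w.comap e.symm.toRingEquiv.toRingHom, fun a b c d => ?_⟩
  rw [← hq a b c d]
  change w (e.symm (e _)) = _
  rw [AlgEquiv.symm_apply_apply]
  exact valuation_quaternionNorm hε hϖ hϖ1 hgen hπ _

end QuaternionValuation

/-! ### Principal units of a valued division ring -/

section OneUnits

variable {D Γ₀ : Type*} [DivisionRing D] [LinearOrderedCommGroupWithZero Γ₀]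

theorem Valuation.map_eq_one_of_map_sub_one_lt {W : Valuation D Γ₀} {x : D} (hx : W (x - 1) < 1) :
    W x = 1 := by
  rw [← sub_add_cancel x 1, Valuation.map_add_eq_of_lt_right _ (by simpa using hx), map_one]

/-- The principal units of level `γ` of a valued division ring. -/
def Valuation.oneUnits (W : Valuation D Γ₀) (γ : Γ₀ˣ) : Subgroup Dˣ where
  -- The bound by 1 matters when γ > 1: it ensures W x = 1, which closure under products and
  -- inverses needs.
  carrier := {x | W ((x : D) - 1) < γ ∧ W ((x : D) - 1) < 1}
  one_mem' := by simp [zero_lt_iff]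
  mul_mem' := by
    rintro x y ⟨hx, hx1⟩ ⟨hy, hy1⟩
    have hy' : W (y : D) = 1 := map_eq_one_of_map_sub_one_lt hy1
    have h : ((x * y : Dˣ) : D) - 1 = (x - 1) * y + (y - 1) := by
      rw [Units.val_mul, sub_mul, one_mul, sub_add_sub_cancel]
    simp only [Set.mem_ofPred_eq, h]
    constructor <;> refine Valuation.map_add_lt _ ?_ (by assumption) <;>
      rw [map_mul, hy', mul_one] <;> assumption
  inv_mem' := by
    rintro x ⟨hx, hx1⟩
    have hx' : W (x : D) = 1 := map_eq_one_of_map_sub_one_lt hx1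
    have h : W (((x⁻¹ : Dˣ) : D) - 1) = W ((x : D) - 1) := by
      have : ((x⁻¹ : Dˣ) : D) - 1 = -(((x⁻¹ : Dˣ) : D) * (x - 1)) := by
        rw [mul_sub, Units.inv_mul, mul_one, neg_sub]
      rw [this, Valuation.map_neg, map_mul, Units.val_inv_eq_inv_val, map_inv₀, hx', inv_one, one_mul]
    simp only [Set.mem_ofPred_eq, h]
    exact ⟨hx, hx1⟩

namespace Valuation

theorem mem_oneUnits {W : Valuation D Γ₀} {γ : Γ₀ˣ} {x : Dˣ} :
    x ∈ W.oneUnits γ ↔ W ((x : D) - 1) < γ ∧ W ((x : D) - 1) < 1 := Iff.rfl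

theorem mem_oneUnits_one {W : Valuation D Γ₀} {x : Dˣ} :
    x ∈ W.oneUnits 1 ↔ W ((x : D) - 1) < 1 := by
  simp [mem_oneUnits]

theorem map_eq_one_of_mem_oneUnits {W : Valuation D Γ₀} {γ : Γ₀ˣ} {x : Dˣ}
    (hx : x ∈ W.oneUnits γ) : W (x : D) = 1 :=
  map_eq_one_of_map_sub_one_lt hx.2

instance oneUnits_normal (W : Valuation D Γ₀) (γ : Γ₀ˣ) : (W.oneUnits γ).Normal := by
  refine ⟨fun x hx g => ?_⟩
  have h : ((g * x * g⁻¹ : Dˣ) : D) - 1 = g * (x - 1) * ((g⁻¹ : Dˣ) : D) := by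
    simp [mul_sub, sub_mul]
  have hg : W (g : D) ≠ 0 := (Valuation.ne_zero_iff _).2 g.ne_zero
  rw [mem_oneUnits, h, map_mul, map_mul, Units.val_inv_eq_inv_val, map_inv₀, mul_right_comm,
    mul_inv_cancel₀ hg, one_mul]
  exact hx

theorem oneUnits_le_one (W : Valuation D Γ₀) (γ : Γ₀ˣ) : W.oneUnits γ ≤ W.oneUnits 1 :=
  fun _ hx => mem_oneUnits_one.2 hx.2

theorem inv_mul_mem_oneUnits_one {W : Valuation D Γ₀} {x y : Dˣ} (hx : W (x : D) = 1) :
    x⁻¹ * y ∈ W.oneUnits 1 ↔ W ((x : D) - y) < 1 := by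
  rw [mem_oneUnits_one]
  have : ((x⁻¹ * y : Dˣ) : D) - 1 = ((x⁻¹ : Dˣ) : D) * (y - x) := by simp [mul_sub]
  rw [this, map_mul, Units.val_inv_eq_inv_val, map_inv₀, hx, inv_one, one_mul, Valuation.map_sub_swap]

variable [TopologicalSpace D] [IsTopologicalRing D]

theorem oneUnits_mem_nhds (W : Valuation D Γ₀)
    (hW : (𝓝 (0 : D)).HasBasis (fun γ : Γ₀ => γ ≠ 0) fun γ => {x | W x < γ}) (γ : Γ₀ˣ) :
    (W.oneUnits γ : Set Dˣ) ∈ 𝓝 1 := by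
  have hc : Filter.Tendsto (fun x : Dˣ => (x : D) - 1) (𝓝 1) (𝓝 0) := by
    have : Continuous fun x : Dˣ => (x : D) - 1 := Units.continuous_val.sub continuous_const
    simpa using this.tendsto 1
  filter_upwards [hc (hW.mem_of_mem γ.ne_zero), hc (hW.mem_of_mem one_ne_zero)] with x h1 h2
  exact ⟨h1, h2⟩

/-- The topology of Dˣ controls x and x⁻¹ together; the `oneUnits` are subgroups, so a bound on x
bounds x⁻¹ too. -/
theorem exists_oneUnits_subset (W : Valuation D Γ₀)
    (hW : (𝓝 (0 : D)).HasBasis (fun γ : Γ₀ => γ ≠ 0) fun γ => {x | W x < γ})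
    {N : Set Dˣ} (hN : N ∈ 𝓝 1) : ∃ γ : Γ₀ˣ, (W.oneUnits γ : Set Dˣ) ⊆ N := by
  rw [Units.isInducing_embedProduct.nhds_eq_comap, map_one, Filter.mem_comap] at hN
  obtain ⟨t, ht, htN⟩ := hN
  rw [Prod.one_eq_mk, mem_nhds_prod_iff] at ht
  obtain ⟨A, hA, B, hB, hAB⟩ := ht
  have key : ∀ C ∈ 𝓝 (1 : D), ∃ γ : Γ₀, γ ≠ 0 ∧ ∀ x, W (x - 1) < γ → x ∈ C := fun C hC => by
    have hc : Filter.Tendsto (fun x : D => x + 1) (𝓝 0) (𝓝 1) := by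
      simpa using (continuous_add_const (1 : D)).tendsto 0
    obtain ⟨γ, hγ, h⟩ := hW.mem_iff.1 (hc hC)
    exact ⟨γ, hγ, fun x hx => by simpa using h hx⟩
  obtain ⟨γ₁, h₁, hγ₁⟩ := key A hA
  obtain ⟨γ₂, h₂, hγ₂⟩ := key (MulOpposite.op ⁻¹' B) (by
    refine MulOpposite.continuous_op.continuousAt.preimage_mem_nhds ?_
    simpa using hB)
  have hmin : min γ₁ γ₂ ≠ 0 := by
    rcases min_choice γ₁ γ₂ with h | h <;> rw [h] <;> assumption
  refine ⟨Units.mk0 _ hmin, fun x hx => htN (hAB ⟨hγ₁ _ ?_, hγ₂ _ ?_⟩)⟩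
  · exact hx.1.trans_le (min_le_left _ _)
  · exact ((W.oneUnits _).inv_mem hx).1.trans_le (min_le_right _ _)

/-- In odd residue characteristic the group of principal units is pro-odd. -/
theorem odd_relIndex_oneUnits (W : Valuation D Γ₀)
    (hW : (𝓝 (0 : D)).HasBasis (fun γ : Γ₀ => γ ≠ 0) fun γ => {x | W x < γ})
    {C : Set D} (hC : IsCompact C) (hWC : ∀ x, W x ≤ 1 → x ∈ C) (h2 : W 2 = 1) (γ : Γ₀ˣ) :
    Odd ((W.oneUnits γ).relIndex (W.oneUnits 1)) := by
  -- Finitely many γ-balls cover the integers, and units in the same ball lie in the same coset, so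
  -- the index is finite.
  obtain ⟨t, ht⟩ := hC.elim_nhds_subcover' (fun x _ => {y | W (y - x) < γ}) (fun x _ => by
    have hc : Filter.Tendsto (fun y : D => y - x) (𝓝 x) (𝓝 0) := by
      simpa using (continuous_sub_right x).tendsto x
    exact hc (hW.mem_of_mem γ.ne_zero))
  have hex : ∀ u : W.oneUnits 1, ∃ x : t, W (((u : Dˣ) : D) - x) < γ := fun u => by
    have := ht (hWC _ (map_eq_one_of_mem_oneUnits u.2).le)
    simp only [Set.mem_iUnion] at this
    obtain ⟨x, hx, h⟩ := this
    exact ⟨⟨x, hx⟩, h⟩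
  choose f hf using hex
  have hfin : Finite (W.oneUnits 1 ⧸ (W.oneUnits γ).subgroupOf (W.oneUnits 1)) := by
    refine Finite.of_injective (fun a => f a.out) fun a b hab => ?_
    rw [← QuotientGroup.out_eq' a, ← QuotientGroup.out_eq' b]
    refine QuotientGroup.eq.2 ?_
    have hab' : f a.out = f b.out := hab
    have ha := hf a.out
    rw [hab', Valuation.map_sub_swap] at ha
    have h := W.map_add_lt ha (hf b.out)
    have heq : ∀ x y z : D, x - y + (z - x) = z - y := fun x y z => by abel
    rw [heq] at h
    have hmem := ((a.out)⁻¹ * b.out).2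
    refine ⟨?_, hmem.2⟩
    have h' : ∀ x y : Dˣ, ((x⁻¹ * y : Dˣ) : D) - 1 = ((x⁻¹ : Dˣ) : D) * (y - x) := fun x y => by
      simp [mul_sub]
    change W ((((a.out : Dˣ)⁻¹ * (b.out : Dˣ) : Dˣ) : D) - 1) < γ
    rw [h', map_mul, Units.val_inv_eq_inv_val, map_inv₀, map_eq_one_of_mem_oneUnits a.out.2,
      inv_one, one_mul]
    exact h
  rw [← Nat.not_even_iff_odd, even_iff_two_dvd]
  intro hdvd
  obtain ⟨a, ha⟩ := exists_prime_orderOf_dvd_card'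
    (G := W.oneUnits 1 ⧸ (W.oneUnits γ).subgroupOf (W.oneUnits 1)) 2 hdvd
  obtain ⟨x, rfl⟩ := QuotientGroup.mk_surjective a
  have hx2 : x ^ 2 ∈ (W.oneUnits γ).subgroupOf (W.oneUnits 1) := by
    rw [← QuotientGroup.eq_one_iff, QuotientGroup.mk_pow, ← ha, pow_orderOf_eq_one]
  -- No element of order two: x² - 1 = (x - 1)(x + 1), and x + 1 has valuation that of 2, which is
  -- 1.
  have hx1 : x ∈ (W.oneUnits γ).subgroupOf (W.oneUnits 1) := by
    have hx := mem_oneUnits_one.1 x.2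
    refine ⟨?_, hx⟩
    have hsum : W (((x : Dˣ) : D) + 1) = 1 := by
      rw [show ((x : Dˣ) : D) + 1 = (x : Dˣ) - 1 + 2 by rw [← one_add_one_eq_two]; abel,
        Valuation.map_add_eq_of_lt_right _ (by rwa [h2]), h2]
    have h : W (((x : Dˣ) : D) ^ 2 - 1) < γ := hx2.1
    rwa [show ((x : Dˣ) : D) ^ 2 - 1 = ((x : Dˣ) - 1) * ((x : Dˣ) + 1) by
      rw [pow_two, sub_mul, mul_add, mul_one, one_mul]; abel, map_mul, hsum, mul_one] at h
  rw [(QuotientGroup.eq_one_iff x).2 hx1, orderOf_one] at ha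
  omega

/-- The principal units have a neighbourhood basis of open normal subgroups of odd index. -/
theorem exists_odd_relIndex_oneUnits (W : Valuation D Γ₀)
    (hW : (𝓝 (0 : D)).HasBasis (fun γ : Γ₀ => γ ≠ 0) fun γ => {x | W x < γ})
    {C : Set D} (hC : IsCompact C) (hWC : ∀ x, W x ≤ 1 → x ∈ C) (h2 : W 2 = 1)
    {N : Set Dˣ} (hN : N ∈ 𝓝 1) :
    ∃ V : Subgroup Dˣ, V.Normal ∧ (V : Set Dˣ) ∈ 𝓝 1 ∧ V ≤ W.oneUnits 1 ∧ (V : Set Dˣ) ⊆ N ∧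
      Odd (V.relIndex (W.oneUnits 1)) := by
  obtain ⟨γ, hγ⟩ := W.exists_oneUnits_subset hW hN
  exact ⟨W.oneUnits γ, inferInstance, W.oneUnits_mem_nhds hW γ, W.oneUnits_le_one γ, hγ,
    W.odd_relIndex_oneUnits hW hC hWC h2 γ⟩

end Valuation

end OneUnits

/-! ### The module topology in terms of the valuation -/

section QuaternionTopology

open ValuativeRel IsLocalRing

variable {F : Type*} [Field F] [ValuativeRel F] [TopologicalSpace F] [IsNonarchimedeanLocalField F]
  {D : Type*} [DivisionRing D] [Algebra F D] [TopologicalSpace D] [IsModuleTopology F D]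

theorem hasBasis_nhds_zero_of_coordinates (e : D ≃ₗ[F] (Fin 4 → F)) {π : F} (hπ0 : π ≠ 0)
    (hπ1 : valuation F π ≤ 1) (W : Valuation D (ValueGroupWithZero F))
    (hW : ∀ y, W (e.symm y) =
      max (max (valuation F (y 0) * valuation F (y 0)) (valuation F (y 1) * valuation F (y 1)))
        (valuation F π *
          max (valuation F (y 2) * valuation F (y 2)) (valuation F (y 3) * valuation F (y 3)))) :
    (𝓝 (0 : D)).HasBasis (fun γ : ValueGroupWithZero F => γ ≠ 0) fun γ => {x | W x < γ} := by
  have := IsModuleTopology.topologicalAddGroup F D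
  have := IsModuleTopology.toContinuousSMul F D
  have hv : 0 < valuation F π := zero_lt_iff.2 ((Valuation.ne_zero_iff _).2 hπ0)
  have hec : Continuous e := IsModuleTopology.continuous_of_linearMap e.toLinearMap
  have hec' : Continuous e.symm := IsModuleTopology.continuous_of_linearMap e.symm.toLinearMap
  have hbasis := IsValuativeTopology.hasBasis_nhds_zero' F
  refine ⟨fun N => ⟨fun hN => ?_, ?_⟩⟩
  · have hN' : e.symm ⁻¹' N ∈ 𝓝 (0 : Fin 4 → F) :=
      hec'.continuousAt.preimage_mem_nhds (by rwa [map_zero])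
    rw [nhds_pi, Filter.mem_pi] at hN'
    obtain ⟨I, -, t, ht, hIt⟩ := hN'
    have hδ : ∃ δ : ValueGroupWithZero F, δ ≠ 0 ∧ ∀ i, ∀ a, valuation F a < δ → a ∈ t i := by
      choose δ hδ0 hδ using fun i => hbasis.mem_iff.1 (ht i)
      refine ⟨Finset.univ.inf' ⟨0, Finset.mem_univ _⟩ δ, ?_, fun i a ha => hδ i ?_⟩
      · obtain ⟨i, -, hi⟩ := Finset.exists_mem_eq_inf' (⟨0, Finset.mem_univ _⟩ :
          (Finset.univ : Finset (Fin 4)).Nonempty) δ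
        rw [hi]; exact hδ0 i
      · exact ha.trans_le (Finset.inf'_le _ (Finset.mem_univ i))
    obtain ⟨δ, hδ0, hδ⟩ := hδ
    -- W is quadratic in the coordinates and weights the last two by π, hence this radius.
    refine ⟨valuation F π * (δ * δ), mul_ne_zero hv.ne' (mul_ne_zero hδ0 hδ0), fun x hx => ?_⟩
    obtain ⟨y, rfl⟩ := e.symm.surjective x
    simp only [Set.mem_ofPred_eq, hW, max_lt_iff, mul_max] at hx
    have hle : valuation F π * (δ * δ) ≤ δ * δ := mul_le_of_le_one_left zero_le hπ1
    have hlt : ∀ {a : F}, valuation F a * valuation F a < δ * δ → valuation F a < δ := fun h => by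
      by_contra! h'
      exact absurd h (mul_le_mul' h' h').not_gt
    have hcancel : ∀ {a b : ValueGroupWithZero F}, valuation F π * a < valuation F π * b → a < b :=
      fun h => lt_of_mul_lt_mul_left h zero_le
    refine hIt fun i _ => hδ i _ ?_
    fin_cases i
    · exact hlt (hx.1.1.trans_le hle)
    · exact hlt (hx.1.2.trans_le hle)
    · exact hlt (hcancel hx.2.1)
    · exact hlt (hcancel hx.2.2)
  · rintro ⟨γ, hγ, hγN⟩
    refine Filter.mem_of_superset ?_ hγN
    have hmin : min γ 1 ≠ 0 := by
      rcases min_choice γ 1 with h | h <;> rw [h]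
      · exact hγ
      · exact one_ne_zero
    have hcoord : ∀ i, ∀ᶠ x in 𝓝 (0 : D), valuation F (e x i) < min γ 1 := fun i => by
      have hc : Filter.Tendsto (fun x => e x i) (𝓝 0) (𝓝 0) := by
        have : Continuous fun x => e x i := (continuous_apply i).comp hec
        simpa using this.tendsto 0
      exact hc (hbasis.mem_of_mem hmin)
    filter_upwards [hcoord 0, hcoord 1, hcoord 2, hcoord 3] with x h0 h1 h2 h3
    have hsq : ∀ {a : F}, valuation F a < min γ 1 → valuation F a * valuation F a < γ := fun h =>
      (mul_le_of_le_one_right zero_le (h.le.trans (min_le_right _ _))).trans_lt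
        (h.trans_le (min_le_left _ _))
    rw [← e.symm_apply_apply x, hW]
    refine max_lt (max_lt (hsq h0) (hsq h1)) ?_
    exact (mul_le_of_le_one_left zero_le hπ1).trans_lt (max_lt (hsq h2) (hsq h3))

/-- W x ≤ 1 confines all coordinates to the ball of radius |π|⁻¹. This is cruder than the ring of
integers, but compact. -/
theorem exists_isCompact_of_coordinates (e : D ≃ₗ[F] (Fin 4 → F)) {π : F} (hπ0 : π ≠ 0)
    (hπ1 : valuation F π ≤ 1) (W : Valuation D (ValueGroupWithZero F))
    (hW : ∀ y, W (e.symm y) =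
      max (max (valuation F (y 0) * valuation F (y 0)) (valuation F (y 1) * valuation F (y 1)))
        (valuation F π *
          max (valuation F (y 2) * valuation F (y 2)) (valuation F (y 3) * valuation F (y 3)))) :
    ∃ C : Set D, IsCompact C ∧ ∀ x, W x ≤ 1 → x ∈ C := by
  have := IsModuleTopology.topologicalAddGroup F D
  have := IsModuleTopology.toContinuousSMul F D
  have hv : 0 < valuation F π := zero_lt_iff.2 ((Valuation.ne_zero_iff _).2 hπ0)
  have hec' : Continuous e.symm := IsModuleTopology.continuous_of_linearMap e.symm.toLinearMap
  refine ⟨e.symm '' Set.univ.pi fun _ => {a | valuation F a ≤ valuation F π⁻¹},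
    (isCompact_univ_pi fun _ => IsNonarchimedeanLocalField.isCompact_closedBall F _).image hec',
    fun x hx => ?_⟩
  obtain ⟨y, rfl⟩ := e.symm.surjective x
  simp only [hW, max_le_iff, mul_max] at hx
  have hinv : 1 ≤ (valuation F π)⁻¹ := (one_le_inv₀ hv).2 hπ1
  have h1 : ∀ {a : F}, valuation F π * (valuation F a * valuation F a) ≤ 1 →
      valuation F a ≤ (valuation F π)⁻¹ := fun {a} h => by
    rcases le_total (valuation F a) 1 with h' | h'
    · exact h'.trans hinv
    · have h3 : valuation F π * valuation F a ≤ 1 :=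
        le_trans (mul_le_mul' le_rfl (le_mul_of_one_le_left zero_le h')) h
      calc valuation F a = (valuation F π)⁻¹ * (valuation F π * valuation F a) := by
            rw [inv_mul_cancel_left₀ hv.ne']
        _ ≤ (valuation F π)⁻¹ * 1 := mul_le_mul' le_rfl h3
        _ = (valuation F π)⁻¹ := mul_one _
  refine ⟨y, fun i _ => ?_, rfl⟩
  rw [Set.mem_ofPred_eq, map_inv₀]
  have hle : ∀ {a : F}, valuation F a * valuation F a ≤ 1 →
      valuation F π * (valuation F a * valuation F a) ≤ 1 := fun h => mul_le_one' hπ1 h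
  fin_cases i
  · exact h1 (hle hx.1.1)
  · exact h1 (hle hx.1.2)
  · exact h1 hx.2.1
  · exact h1 hx.2.2

end QuaternionTopology

/-! ### Frobenius on the quadratic residue extension -/

section ResidueField

open ValuativeRel IsLocalRing

variable {k : Type*} [Field k] [Finite k]

/-- Frobenius is the nontrivial automorphism of a quadratic extension of a finite field. -/
theorem QuadraticAlgebra.pow_card_eq_star {e : k} (h2 : (2 : k) ≠ 0) (he : ∀ y : k, e ≠ y * y)
    (z : QuadraticAlgebra k e 0) : z ^ Nat.card k = star z := by
  have : Fact (∀ r : k, r ^ 2 ≠ e + 0 * r) := ⟨fun r h => he r (by linear_combination -h)⟩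
  have := Fintype.ofFinite k
  rw [Nat.card_eq_fintype_card]
  have hchar : ringChar k ≠ 2 := fun h => h2 (by
    have := ringChar.Nat.cast_ringChar (R := k)
    rw [h] at this
    exact_mod_cast this)
  have he0 : e ≠ 0 := by simpa using he 0
  have hnsq : ¬ IsSquare e := fun ⟨y, hy⟩ => he y hy
  -- Euler's criterion gives ω^q = ω (ω²)^((q - 1)/2) = -ω; Frobenius is k-linear, so this
  -- determines it.
  have heuler : e ^ (Fintype.card k / 2) = -1 :=
    (FiniteField.pow_dichotomy hchar he0).resolve_left fun h =>
      hnsq ((FiniteField.isSquare_iff hchar he0).2 h)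
  have homega : (QuadraticAlgebra.omega : QuadraticAlgebra k e 0) ^ Fintype.card k =
      -QuadraticAlgebra.omega := by
    have hodd := FiniteField.odd_card_of_char_ne_two hchar
    have hsq : (QuadraticAlgebra.omega : QuadraticAlgebra k e 0) ^ 2 = algebraMap k _ e := by
      rw [pow_two, QuadraticAlgebra.omega_mul_omega_eq_algebraMap]; simp
    conv_lhs => rw [← Nat.div_add_mod (Fintype.card k) 2, hodd, pow_succ, pow_mul, hsq, ← map_pow,
      heuler, map_neg, map_one, neg_one_mul]
  have hfrob := map_add (FiniteField.frobeniusAlgHom k (QuadraticAlgebra k e 0))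
    (algebraMap k _ z.re) (z.im • QuadraticAlgebra.omega)
  rw [AlgHom.commutes, map_smul, FiniteField.frobeniusAlgHom_apply, FiniteField.frobeniusAlgHom_apply,
    homega, ← QuadraticAlgebra.mk_eq_add_smul_omega] at hfrob
  rw [show z = ⟨z.re, z.im⟩ from rfl, hfrob]
  ext <;> simp

theorem QuadraticAlgebra.nat_card {R : Type*} (a b : R) :
    Nat.card (QuadraticAlgebra R a b) = Nat.card R * Nat.card R := by
  rw [Nat.card_congr (QuadraticAlgebra.equivProd a b), Nat.card_prod]

end ResidueField

/-! ### The structure of Dˣ modulo principal units -/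

section UnitGroup

open ValuativeRel IsLocalRing

variable {F : Type*} [Field F] [ValuativeRel F]

/-- The reduction of the quadratic order `𝒪[F][√ε]` modulo the maximal ideal of `𝒪[F]`. -/
noncomputable def quadraticResidue (ε : 𝒪[F]) :
    QuadraticAlgebra 𝒪[F] ε 0 →+* QuadraticAlgebra 𝓀[F] (residue 𝒪[F] ε) 0 where
  toFun z := ⟨residue 𝒪[F] z.re, residue 𝒪[F] z.im⟩
  map_zero' := by ext <;> simp
  map_one' := by ext <;> simp [QuadraticAlgebra.re_one, QuadraticAlgebra.im_one]
  map_add' x y := by ext <;> simp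
  map_mul' x y := by ext <;> simp

variable [TopologicalSpace F] [IsNonarchimedeanLocalField F]

theorem quadraticResidue_eq_zero_iff {ε : 𝒪[F]} (z : QuadraticAlgebra 𝒪[F] ε 0) :
    quadraticResidue ε z = 0 ↔ valuation F z.re < 1 ∧ valuation F z.im < 1 := by
  rw [← residue_eq_zero_iff_valuation_lt_one, ← residue_eq_zero_iff_valuation_lt_one,
    QuadraticAlgebra.ext_iff]
  rfl

/-- A lift of a generator of the multiplicative group of the residue field of the unramified
quadratic extension. -/
theorem exists_quadraticResidue_generator (hF : ringChar 𝓀[F] ≠ 2) {ε : 𝒪[F]}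
    (hε : ∀ y : 𝓀[F], residue 𝒪[F] ε ≠ y * y) :
    ∃ ζ : QuadraticAlgebra 𝒪[F] ε 0, quadraticResidue ε ζ ≠ 0 ∧
      (∀ z, quadraticResidue ε z ≠ 0 → ∃ i : ℕ, quadraticResidue ε (z - ζ ^ i) = 0) ∧
      (∀ i : ℕ, quadraticResidue ε (ζ ^ i - 1) = 0 ↔
        (Nat.card 𝓀[F] - 1) * (Nat.card 𝓀[F] + 1) ∣ i) ∧
      quadraticResidue ε (star ζ - ζ ^ Nat.card 𝓀[F]) = 0 := by
  have : Fact (∀ r : 𝓀[F], r ^ 2 ≠ residue 𝒪[F] ε + 0 * r) :=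
    ⟨fun r h => hε r (by linear_combination -h)⟩
  have : Finite (QuadraticAlgebra 𝓀[F] (residue 𝒪[F] ε) 0) :=
    Finite.of_equiv _ (QuadraticAlgebra.equivProd _ _).symm
  obtain ⟨g, hg⟩ := IsCyclic.exists_generator
    (α := (QuadraticAlgebra 𝓀[F] (residue 𝒪[F] ε) 0)ˣ)
  obtain ⟨ζ, hζ⟩ : ∃ ζ, quadraticResidue ε ζ = g := by
    obtain ⟨a, ha⟩ := residue_surjective (g : QuadraticAlgebra 𝓀[F] (residue 𝒪[F] ε) 0).re
    obtain ⟨b, hb⟩ := residue_surjective (g : QuadraticAlgebra 𝓀[F] (residue 𝒪[F] ε) 0).im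
    exact ⟨⟨a, b⟩, QuadraticAlgebra.ext ha hb⟩
  have hord : orderOf g = (Nat.card 𝓀[F] - 1) * (Nat.card 𝓀[F] + 1) := by
    rw [orderOf_eq_card_of_forall_mem_zpowers hg, Nat.card_units, QuadraticAlgebra.nat_card]
    have := Nat.mul_self_sub_mul_self_eq (Nat.card 𝓀[F]) 1
    rw [mul_one, mul_comm (Nat.card 𝓀[F] + 1)] at this
    exact this
  refine ⟨ζ, hζ ▸ g.ne_zero, fun z hz => ?_, fun i => ?_, ?_⟩
  · obtain ⟨i, hi⟩ := (mem_powers_iff_mem_zpowers (x := g)).2 (hg (Units.mk0 _ hz))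
    refine ⟨i, ?_⟩
    rw [map_sub, map_pow, hζ, sub_eq_zero]
    exact (congrArg Units.val hi).symm
  · rw [map_sub, map_pow, hζ, map_one, sub_eq_zero, ← hord, orderOf_dvd_iff_pow_eq_one,
      ← Units.val_pow_eq_pow_val, Units.val_eq_one]
  · rw [map_sub, map_pow, QuadraticAlgebra.pow_card_eq_star (residue_two_ne_zero hF) hε, sub_eq_zero]
    ext <;> simp [quadraticResidue]

/-- If the `ℂˣ`-cover obtained from a 2-fold cover of the unit group of a quaternion division
algebra splits over the unramified torus, then it splits. -/
theorem TwoFoldCover.extensionSplits_of_unramified_torus (hF : ringChar 𝓀[F] ≠ 2)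
    {D : Type*} [DivisionRing D] [Algebra F D] [Algebra.IsCentral F D]
    (hD : Module.finrank F D = 4) [TopologicalSpace D] [IsModuleTopology F D]
    {M : Type*} [Field M] [Algebra F M] (hM : Module.finrank F M = 2)
    (hM' : IsUnramifiedExtension F M) (i : M →ₐ[F] D)
    {E : Type*} [Group E] [TopologicalSpace E] [IsTopologicalGroup E] (c : TwoFoldCover Dˣ E)
    (h : ExtensionSplitsOver c.complexProj (Units.map (i : M →* D)).range) :
    ExtensionSplits c.complexProj := by
  have h2 := two_ne_zero_of_residue hF
  have hFD : FiniteDimensional F D := FiniteDimensional.of_finrank_pos (by omega)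
  have hTR : IsTopologicalRing D := IsModuleTopology.isTopologicalRing F D
  obtain ⟨ϖ, hϖ, hϖ1, hgen⟩ := exists_uniformizer F
  obtain ⟨α, ε, hαα, hαF, hε⟩ := hM'.exists_sqrt_unit hF hM
  have hα : i α * i α = algebraMap F D ε := by rw [← map_mul, hαα, AlgHom.commutes]
  have hαF' : ∀ a, algebraMap F D a ≠ i α := fun a ha => by
    rw [← i.commutes] at ha
    exact hαF a (i.toRingHom.injective ha)
  obtain ⟨j, π, hj, hjα, hjj, hπ⟩ := exists_anticommute_uniformizer hF hD hα hαF' hε hϖ hgen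
  have hπ1 : valuation F π < 1 := hπ ▸ hϖ1
  have hv : 0 < valuation F π := by rw [hπ]; exact zero_lt_iff.2 ((Valuation.ne_zero_iff _).2 hϖ)
  have hπ0 : π ≠ 0 := (Valuation.ne_zero_iff _).1 hv.ne'
  obtain ⟨W, hW⟩ := exists_quaternion_valuation hD h2 hε hϖ hϖ1 hgen hπ hα hαF' hj hjα hjj
  have hli := linearIndependent_quaternion h2 hαF' hj hjα
  let b := basisOfLinearIndependentOfCardEqFinrank hli (by rw [hD]; rfl)
  have hb : ∀ y, b.equivFun.symm y =
      y 0 • (1 : D) + y 1 • i α + y 2 • j + y 3 • (i α * j) := fun y => by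
    simp [b, Module.Basis.equivFun_symm_apply, Fin.sum_univ_four]
  have hWb : ∀ y, W (b.equivFun.symm y) = _ := fun y => (congrArg W (hb y)).trans (hW _ _ _ _)
  have hbasis := hasBasis_nhds_zero_of_coordinates b.equivFun hπ0 hπ1.le W hWb
  obtain ⟨C, hC, hWC⟩ := exists_isCompact_of_coordinates b.equivFun hπ0 hπ1.le W hWb
  have hW2 : W 2 = 1 := by
    have := hW 2 0 0 0
    simp only [zero_smul, add_zero, map_zero, mul_zero, max_self, valuation_two_eq_one hF, mul_one,
      zero_le, sup_of_le_left] at this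
    rwa [← Algebra.algebraMap_eq_smul_one, map_ofNat (algebraMap F D) 2] at this
  have hWj : W j = valuation F π := by
    have := hW 0 0 1 0
    simpa using this
  -- the image of the order `𝒪[F][√ε]`
  let ψ : QuadraticAlgebra 𝒪[F] ε 0 →ₐ[𝒪[F]] M :=
    QuadraticAlgebra.lift ⟨α, by
      rw [zero_smul, add_zero, hαα, ← Algebra.algebraMap_eq_smul_one]; rfl⟩
  have hψ : ∀ z, i (ψ z) = (z.re : F) • (1 : D) + (z.im : F) • i α := fun z => by
    have : ψ z = (z.re : F) • (1 : M) + (z.im : F) • α := rfl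
    rw [this, map_add, map_smul, map_smul, map_one]
  have hWψ : ∀ z, W (i (ψ z)) = max (valuation F z.re * valuation F z.re)
      (valuation F z.im * valuation F z.im) := fun z => by
    have := hW z.re z.im 0 0
    simp only [zero_smul, add_zero, map_zero, mul_zero, max_self, zero_le, sup_of_le_left] at this
    rw [hψ, this]
  have hsq : ∀ a : F, valuation F a * valuation F a < 1 ↔ valuation F a < 1 := fun a => by
    rw [← pow_two]; exact pow_lt_one_iff two_ne_zero
  have hsq' : ∀ a : F, valuation F a * valuation F a ≤ 1 ↔ valuation F a ≤ 1 := fun a => by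
    rw [← pow_two]; exact pow_le_one_iff two_ne_zero
  have hWred : ∀ z, W (i (ψ z)) < 1 ↔ quadraticResidue ε z = 0 := fun z => by
    rw [hWψ, max_lt_iff, hsq, hsq, quadraticResidue_eq_zero_iff]
  have hWψ1 : ∀ z, quadraticResidue ε z ≠ 0 → W (i (ψ z)) = 1 := fun z hz => by
    refine le_antisymm ?_ (not_lt.1 fun h => hz ((hWred z).1 h))
    rw [hWψ]
    exact max_le ((hsq' _).2 z.re.2) ((hsq' _).2 z.im.2)
  obtain ⟨ζ, hζ0, hζgen, hζord, hζstar⟩ := exists_quadraticResidue_generator hF hε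
  set q := Nat.card 𝓀[F]
  have hψζ : ψ ζ ≠ 0 := fun h0 => by
    have := hWψ1 ζ hζ0
    rw [h0, map_zero, map_zero] at this
    exact zero_ne_one this
  let zM : Mˣ := Units.mk0 (ψ ζ) hψζ
  let z : Dˣ := Units.map (i : M →* D) zM
  let w : Dˣ := Units.mk0 j hj
  have hzpow : ∀ n : ℕ, ((z ^ n : Dˣ) : D) = i (ψ (ζ ^ n)) := fun n => by
    rw [map_pow, map_pow]; rfl
  have hWz : W (z : D) = 1 := hWψ1 ζ hζ0
  have hWw : W (w : D) = valuation F π := hWj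
  have hWzpow : ∀ n : ℤ, W ((z ^ n : Dˣ) : D) = 1 := fun n => by
    rw [Units.val_zpow_eq_zpow_val, map_zpow₀, hWz, one_zpow]
  have hzU : ∀ n : ℕ, z ^ n ∈ W.oneUnits 1 ↔ (q - 1) * (q + 1) ∣ n := fun n => by
    rw [Valuation.mem_oneUnits_one, hzpow, ← hζord, ← hWred, map_sub ψ, map_one ψ, map_sub i,
      map_one i]
  have hcoord : ∀ x : D, ∃ a b c d : F, x = a • 1 + b • i α + c • j + d • (i α * j) := fun x =>
    ⟨_, _, _, _, (b.equivFun.symm_apply_apply x).symm.trans (hb _)⟩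
  -- The maximum in the formula is attained at one of a², b², πc², πd², so W takes values in the
  -- value group of F.
  have hWgen : ∀ x : D, x ≠ 0 → ∃ n : ℤ, W x = valuation F π ^ n := fun x hx => by
    obtain ⟨y, hy⟩ : ∃ y : F, W x = valuation F y := by
      obtain ⟨a, b, c, d, rfl⟩ := hcoord x
      rw [hW, mul_max]
      simp only [← map_mul]
      rcases max_choice (max (valuation F (a * a)) (valuation F (b * b)))
        (max (valuation F (π * (c * c))) (valuation F (π * (d * d)))) with h | h <;> rw [h]
      · rcases max_choice (valuation F (a * a)) (valuation F (b * b)) with h | h <;>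
          exact ⟨_, h⟩
      · rcases max_choice (valuation F (π * (c * c))) (valuation F (π * (d * d))) with h | h <;>
          exact ⟨_, h⟩
    rw [hy, hπ]
    refine hgen y fun h0 => ?_
    rw [h0, map_zero] at hy
    exact hx ((Valuation.zero_iff _).1 hy)
  -- The residue ring of D is that of M: the j-part of an integral x has W < 1, and powers of ζ
  -- exhaust the nonzero residues.
  have hWres : ∀ x : D, W x = 1 → ∃ n : ℕ, W (x - (z ^ n : Dˣ)) < 1 := fun x hx => by
    obtain ⟨a, b, c, d, rfl⟩ := hcoord x
    have hle := hx.le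
    rw [hW, max_le_iff, max_le_iff, mul_max, max_le_iff, hsq', hsq'] at hle
    obtain ⟨⟨ha, hb⟩, hc, hd⟩ := hle
    -- Discreteness: |y| > 1 would give |y|⁻¹ ≤ |π|, hence |π||y|² ≥ |y| > 1.
    have h_int : ∀ y : F, valuation F π * (valuation F y * valuation F y) ≤ 1 →
        valuation F y ≤ 1 := fun y hy => by
      by_contra! hy1
      have hy0 : 0 < valuation F y := zero_lt_one.trans hy1
      have h1 : valuation F y⁻¹ ≤ valuation F π := by
        rw [hπ]
        refine valuation_le_uniformizer hϖ hϖ1 hgen ?_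
        rw [map_inv₀]
        exact inv_lt_one_of_one_lt₀ hy1
      have h2 : valuation F y ≤ valuation F π * (valuation F y * valuation F y) := by
        calc valuation F y = valuation F y⁻¹ * (valuation F y * valuation F y) := by
              rw [map_inv₀, inv_mul_cancel_left₀ hy0.ne']
          _ ≤ _ := mul_le_mul' h1 le_rfl
      exact absurd (hy1.trans_le (h2.trans hy)) (lt_irrefl _)
    have hlt : W (c • j + d • (i α * j)) < 1 := by
      have := hW 0 0 c d
      simp only [zero_smul, zero_add, map_zero, mul_zero, max_self, zero_le, sup_of_le_right] at this
      rw [this]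
      exact mul_lt_one_of_lt_of_le hπ1 (max_le ((hsq' c).2 (h_int c hc)) ((hsq' d).2 (h_int d hd)))
    set y : QuadraticAlgebra 𝒪[F] ε 0 := ⟨⟨a, ha⟩, ⟨b, hb⟩⟩
    have hy : i (ψ y) = a • (1 : D) + b • i α := hψ y
    rw [add_assoc, ← hy] at hx ⊢
    have hy0 : quadraticResidue ε y ≠ 0 := fun h0 => by
      have := W.map_add_lt ((hWred y).2 h0) hlt
      rw [hx] at this
      exact lt_irrefl _ this
    obtain ⟨n, hn⟩ := hζgen y hy0
    refine ⟨n, ?_⟩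
    rw [hzpow, add_sub_right_comm, ← map_sub i, ← map_sub ψ]
    exact W.map_add_lt ((hWred _).2 hn) hlt
  have hww : ((w ^ 2 : Dˣ) : D) = algebraMap F D π := by
    rw [Units.val_pow_eq_pow_val, pow_two]; exact hjj
  have hwz : (w : D) * z = i (ψ (star ζ)) * w := by
    change j * i (ψ ζ) = i (ψ (star ζ)) * j
    rw [hψ, hψ]
    simp [mul_add, add_mul, hjα]
  refine c.extensionSplits_complexProj (W.oneUnits 1) inferInstance
    (fun N hN => W.exists_odd_relIndex_oneUnits hbasis hC hWC hW2 hN) (z := z) (w := w) (q := q)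
    Finite.one_lt_card ?_ ?_ ((hzU _).2 dvd_rfl) ?_ (Units.map (i : M →* D)).range ⟨zM, rfl⟩
    ?_ ?_ h
  · intro g
    obtain ⟨k, hk⟩ := hWgen g g.ne_zero
    have hu : W ((g * (w ^ k)⁻¹ : Dˣ) : D) = 1 := by
      rw [Units.val_mul, map_mul, Units.val_inv_eq_inv_val, map_inv₀, Units.val_zpow_eq_zpow_val,
        map_zpow₀, hWw, hk, mul_inv_cancel₀ (zpow_ne_zero _ hv.ne')]
    obtain ⟨n, hn⟩ := hWres _ hu
    refine ⟨n, k, ?_⟩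
    have := (W.oneUnits_normal 1).conj_mem _ ((Valuation.inv_mul_mem_oneUnits_one hu).2 hn) (w ^ k)⁻¹
    simpa [mul_assoc] using this
  · intro n k hnk
    have h1 := Valuation.map_eq_one_of_mem_oneUnits hnk
    rw [Units.val_mul, map_mul, hWzpow, one_mul, Units.val_zpow_eq_zpow_val, map_zpow₀, hWw,
      zpow_eq_one_iff_right₀ zero_le hπ1.ne] at h1
    refine ⟨h1, ?_⟩
    rw [h1, zpow_zero, mul_one] at hnk
    obtain ⟨m, rfl | rfl⟩ := Int.eq_nat_or_neg n
    · rw [zpow_natCast, hzU] at hnk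
      exact Int.natCast_dvd_natCast.2 hnk
    · rw [zpow_neg, inv_mem_iff, zpow_natCast, hzU] at hnk
      exact (Int.natCast_dvd_natCast.2 hnk).neg_right
  -- Conjugation by j is the conjugation of M over F, which reduces to Frobenius on residues.
  · have hconj : ((w * z * w⁻¹ : Dˣ) : D) = i (ψ (star ζ)) := by
      rw [Units.val_mul, Units.val_mul, hwz, mul_assoc, Units.mul_inv, mul_one]
    rw [Valuation.inv_mul_mem_oneUnits_one, hconj, hzpow, ← map_sub i, ← map_sub ψ, hWred]
    · exact hζstar
    · rw [Units.val_mul, Units.val_mul, map_mul, map_mul, hWz, mul_one, ← map_mul, Units.mul_inv,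
        map_one]
  -- w² = π lies in Fˣ, hence in Mˣ, and is central.
  · refine ⟨Units.mk0 (algebraMap F M π) ((map_ne_zero _).2 hπ0), Units.ext ?_⟩
    rw [hww]
    exact i.commutes π
  · refine Units.ext ?_
    rw [Units.val_mul, Units.val_mul, hww]
    exact (Algebra.commutes π (z : D)).symm

end UnitGroup

/-! ### The main theorem -/

theorem proposition4p5
    {F : Type*} [Field F] [ValuativeRel F] [TopologicalSpace F] [IsNonarchimedeanLocalField F]
    (hF : ringChar 𝓀[F] ≠ 2)
    {D : Type*} [DivisionRing D] [Algebra F D] [Algebra.IsCentral F D]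
    (hD : Module.finrank F D = 4)
    [TopologicalSpace D] [IsModuleTopology F D]
    {M : Type*} [Field M] [Algebra F M] (hM : Module.finrank F M = 2)
    (hM' : IsUnramifiedExtension F M) (i : M →ₐ[F] D)
    {E : Type*} [Group E] [TopologicalSpace E] [IsTopologicalGroup E]
    (c : TwoFoldCover Dˣ E) (hc : ¬ ExtensionSplits c.complexProj) :
    ¬ ExtensionSplitsOver c.proj.toMonoidHom (Units.map (i : M →* D)).range ∧
      ¬ ExtensionSplitsOver c.complexProj (Units.map (i : M →* D)).range := by
  have h : ¬ ExtensionSplitsOver c.complexProj (Units.map (i : M →* D)).range := fun h =>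
    hc (c.extensionSplits_of_unramified_torus hF hD hM hM' i h)
  exact ⟨fun h' => h (c.extensionSplitsOver_complexProj h'), h⟩
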